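/- Let $n\ge 1$ and let $A=V/\Gamma$ be a complex torus of complex dimension $2n$, where $V$ is a complex vector space of dimension $2n$ and $\Gamma\subset V$ is a lattice of full rank $4n$. Write $V_{\mathbb R}$ for the underlying real vector space, and let $Compl\subset \mathrm{End}(V_{\mathbb R})$ be the orbit of the complex structure of $V$ (multiplication by $i$) under conjugation by the group $GL^+(V_{\mathbb R})$ of real automorphisms with positive determinant, so that $Compl\cong GL^+_{4n}(\mathbb R)/GL_{2n}(\mathbb C)$. It is a complex manifold of dimension $4n^2$, whose complex structure is given at $I\in Compl$ by left multiplication by $I$ on $T_I Compl=\{T\in \mathrm{End}(V_{\mathbb R}) : TI=-IT\}$. A point $I\in Compl$ (a period) corresponds to the complex torus $A_I=(V_{\mathbb R},I)/\Gamma$. Its Néron–Severi group $NS(A_I)$ is the group of alternating real bilinear forms $\Omega$ on $V_{\mathbb R}$ with $\Omega(\Gamma,\Gamma)\subset\mathbb Z$ and $\Omega(Ix,Iy)=\Omega(x,y)$ for all $x,y\in V_{\mathbb R}$. For $I\in Compl$ and $J\in\mathrm{End}(V_{\mathbb R})$ with $J^2=-1$ and $IJ=-JI$, put $K=IJ$;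 the twistor sphere of $(I,J)$ is $$S(I,J)=\{aI+bJ+cK : a,b,c\in\mathbb R,\ a^2+b^2+c^2=1\}.$$ It is contained in $Compl$. Then: 1. Every twistor sphere is embedded in $Compl$ as a complex submanifold of dimension 1: for all $I,J$ as above there is a structure of a 1-dimensional complex manifold on the unit sphere $S^2\subset\mathbb R^3$ (with its usual topology) for which the map $S^2\to Compl$, $(a,b,c)\mapsto aI+bJ+cK$, is a holomorphic embedding (a holomorphic immersion that is a homeomorphism onto its image). 2. Any two periods $P,Q\in Compl$ can be joined by a generic chain of twistor lines: there are twistor spheres $S_0,\dots,S_m\subset Compl$ with $P\in S_0$ and $Q\in S_m$ such that, for $0\le k<m$, the intersection $S_k\cap S_{k+1}$ is non-empty and every period $I\in S_k\cap S_{k+1}$ satisfies $NS(A_I)=0$. -/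

import Mathlib

open scoped Manifold ContDiff ComplexConjugate

noncomputable section

namespace TwistorPath

variable (V : Type*) [NormedAddCommGroup V] [NormedSpace ℂ V]

/-- Real endomorphisms of the complex vector space `V`, i.e. `End(V_ℝ)`. -/
abbrev REnd := V →L[ℝ] V

/-- Conjugate-linear endomorphisms of `V`, a complex vector space through
`(c • X) v = c • X v`. If `dim V = 2n`, its complex dimension is `4n²`. -/
abbrev Anti := V →SL[starRingEnd ℂ] V

/-- The given complex structure of `V`: multiplication by `i`. -/
def stdJ : REnd V := Complex.I • (1 : REnd V)

/-- `GL⁺(V_ℝ)`: the real automorphisms with positive determinant. -/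
def GLPlus : Subgroup (REnd V)ˣ where
  carrier := {g | 0 < (g : REnd V).det}
  mul_mem' {a b} ha hb := by
    have : ((a * b : (REnd V)ˣ) : REnd V).det = (a : REnd V).det * (b : REnd V).det :=
      LinearMap.det_comp _ _
    show 0 < ((a * b : (REnd V)ˣ) : REnd V).det
    rw [this]
    exact mul_pos ha hb
  one_mem' := by
    have : ((1 : (REnd V)ˣ) : REnd V).det = 1 := LinearMap.det_id
    show 0 < ((1 : (REnd V)ˣ) : REnd V).det
    rw [this]
    exact one_pos
  inv_mem' {a} ha := by
    have h : (a : REnd V).det * ((a⁻¹ : (REnd V)ˣ) : REnd V).det = 1 := by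
      have h1 : ((a : REnd V) * ((a⁻¹ : (REnd V)ˣ) : REnd V)).det
          = (a : REnd V).det * ((a⁻¹ : (REnd V)ˣ) : REnd V).det := LinearMap.det_comp _ _
      rw [← h1, Units.mul_inv]
      exact LinearMap.det_id
    exact pos_of_mul_pos_right (h ▸ one_pos) (le_of_lt ha)

/-- The period domain: the orbit, under conjugation by `GL⁺(V_ℝ)`, of the complex structure of `V`
in `End(V_ℝ)`. The stabilizer of the base point is `GL(V)`. -/
def Compl : Set (REnd V) :=
  {I | ∃ g ∈ GLPlus V, I = (g : REnd V) * stdJ V * ((g⁻¹ : (REnd V)ˣ) : REnd V)}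

variable {V}

/-- A conjugate-linear map, as a real-linear map. -/
def Anti.toReal (X : Anti V) : REnd V where
  toFun := X
  map_add' := X.map_add
  map_smul' r x := by
    have h := X.map_smulₛₗ (r : ℂ) x
    rw [Complex.conj_ofReal, Complex.coe_smul, Complex.coe_smul] at h
    exact h
  cont := X.continuous

/-- The conjugate-linear part `(T + iTi)/2` of a real-linear map `T`. -/
def antiPart (T : REnd V) : Anti V where
  toFun x := (1 / 2 : ℂ) • (T x + Complex.I • T (Complex.I • x))
  map_add' x y := by simp only [smul_add, map_add]; abel
  map_smul' c x := by
    have key : ∀ (r : ℝ) (y : V), T ((r : ℂ) • y) = (r : ℂ) • T y := fun r y => by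
      simp
    have e1 : c • x = (c.re : ℂ) • x + (c.im : ℂ) • (Complex.I • x) := by
      rw [smul_smul, ← add_smul, Complex.re_add_im]
    have e2 : Complex.I • c • x = (c.re : ℂ) • (Complex.I • x) + (-c.im : ℝ) • x := by
      rw [e1, smul_add, smul_smul, smul_smul, smul_smul, ← Complex.coe_smul]
      congr 1
      · rw [smul_smul, mul_comm]
      · congr 1
        push_cast
        linear_combination (c.im : ℂ) * Complex.I_mul_I
    rw [e2, e1]
    simp only [map_add, key, map_smul]
    have hc : (starRingEnd ℂ) c = (c.re : ℂ) - c.im * Complex.I := by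
      apply Complex.ext <;> simp
    rw [hc, ← Complex.coe_smul]
    push_cast
    match_scalars <;>
      first
        | ring1
        | linear_combination (-c.im / 2 : ℂ) * Complex.I_sq
        | linear_combination (c.im / 2 : ℂ) * Complex.I_sq
  cont := by fun_prop

/-- The holomorphic coordinate centred at the base point `i`. For a complex structure `I` with
`I + i` invertible it is the unique conjugate-linear `X` with `I (1 + X) = (1 + X) i`, i.e. with
`I = (1 + X) i (1 + X)⁻¹` where `1 + X` is invertible. Multiplying `X` by a scalar `c` multiplies
a tangent vector `dI = X i - i X` at `I = i` on the left by `c`. -/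
def coord (I : REnd V) : Anti V :=
  antiPart (Ring.inverse (I + stdJ V) * (stdJ V - I))


lemma stdJ_mul_self : stdJ V * stdJ V = -1 := by
  ext x
  simp [stdJ, smul_smul]

lemma toReal_mul_stdJ (X : Anti V) : X.toReal * stdJ V = -(stdJ V * X.toReal) := by
  ext x
  simp [stdJ, Anti.toReal]

lemma toReal_antiPart {T : REnd V} (h : T * stdJ V = -(stdJ V * T)) :
    (antiPart T).toReal = T := by
  ext x
  have h1 : T (Complex.I • x) = -(Complex.I • T x) := by
    simpa [stdJ] using congrArg (fun S : REnd V => S x) h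
  simp only [Anti.toReal, antiPart, ContinuousLinearMap.coe_mk', LinearMap.coe_mk, AddHom.coe_mk,
    h1, smul_neg, smul_smul, Complex.I_mul_I]
  module

lemma toReal_injective : Function.Injective (Anti.toReal : Anti V → REnd V) := by
  intro X Y h
  ext x
  exact congrArg (fun S : REnd V => S x) h

lemma antiPart_toReal (X : Anti V) : antiPart X.toReal = X :=
  toReal_injective (toReal_antiPart (toReal_mul_stdJ X))

lemma continuous_toReal : Continuous (Anti.toReal : Anti V → REnd V) := by
  let f : Anti V →+ REnd V :=
    { toFun := Anti.toReal
      map_zero' := by ext x; rfl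
      map_add' := fun X Y => by ext x; rfl }
  refine AddMonoidHomClass.continuous_of_bound f 1 fun X => ?_
  rw [one_mul]
  exact ContinuousLinearMap.opNorm_le_bound _ (norm_nonneg _) fun x => X.le_opNorm x

lemma continuous_antiPart : Continuous (antiPart : REnd V → Anti V) := by
  let f : REnd V →+ Anti V :=
    { toFun := antiPart
      map_zero' := by ext x; simp [antiPart]
      map_add' := fun X Y => by
        ext x
        simp only [antiPart, ContinuousLinearMap.coe_mk', LinearMap.coe_mk, AddHom.coe_mk,
          add_apply]
        module }
  refine AddMonoidHomClass.continuous_of_bound f 1 fun T => ?_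
  rw [one_mul]
  refine ContinuousLinearMap.opNorm_le_bound _ (norm_nonneg _) fun x => ?_
  show ‖(1 / 2 : ℂ) • (T x + Complex.I • T (Complex.I • x))‖ ≤ _
  have h1 := T.le_opNorm x
  have h2 := T.le_opNorm (Complex.I • x)
  have h3 := norm_add_le (T x) (Complex.I • T (Complex.I • x))
  rw [norm_smul] at h2 h3 ⊢
  simp only [Complex.norm_I, one_mul] at h2 h3
  have h4 : ‖(1 / 2 : ℂ)‖ = 1 / 2 := by simp
  rw [h4]
  linarith

lemma det_mul (S T : REnd V) : (S * T).det = S.det * T.det := LinearMap.det_comp _ _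

lemma Compl.sq {I : REnd V} (h : I ∈ Compl V) : I * I = -1 := by
  obtain ⟨g, -, rfl⟩ := h
  calc (g : REnd V) * stdJ V * ((g⁻¹ : (REnd V)ˣ) : REnd V)
        * (g * stdJ V * ((g⁻¹ : (REnd V)ˣ) : REnd V))
      = g * (stdJ V * stdJ V) * ((g⁻¹ : (REnd V)ˣ) : REnd V) := by
        simp only [mul_assoc, Units.inv_mul_cancel_left]
    _ = -1 := by rw [stdJ_mul_self]; simp

lemma Compl.conj_mem {I : REnd V} (h : I ∈ Compl V) {k : (REnd V)ˣ} (hk : k ∈ GLPlus V) :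
    (k : REnd V) * I * ((k⁻¹ : (REnd V)ˣ) : REnd V) ∈ Compl V := by
  obtain ⟨g, hg, rfl⟩ := h
  exact ⟨k * g, mul_mem hk hg, by simp [mul_assoc]⟩

variable (V) in
lemma stdJ_mem : stdJ V ∈ Compl V := ⟨1, one_mem _, by simp⟩

/-- If `I + i` is invertible, `T = (I + i)⁻¹ (i - I)` is conjugate-linear, and `1 + T` is
invertible and conjugates `i` into `I`. -/
lemma coord_spec {I : REnd V} (hI : I * I = -1) (hu : IsUnit (I + stdJ V)) :
    IsUnit (1 + (coord I).toReal) ∧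
      I * (1 + (coord I).toReal) = (1 + (coord I).toReal) * stdJ V := by
  obtain ⟨u, hu⟩ := hu
  set j := stdJ V with hj
  have hjj : j * j = -1 := stdJ_mul_self
  set w : REnd V := ((u⁻¹ : (REnd V)ˣ) : REnd V) with hw
  have wu : w * (I + j) = 1 := by rw [← hu]; exact u.inv_mul
  have uw : (I + j) * w = 1 := by rw [← hu]; exact u.mul_inv
  have hwI : w * I = j * w := by
    have : I * (I + j) = (I + j) * j := by rw [mul_add, add_mul, hI, hjj, add_comm]
    calc w * I = w * (I * (I + j)) * w := by rw [mul_assoc w, mul_assoc I, uw, mul_one]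
      _ = j * w := by rw [this, ← mul_assoc, wu, one_mul]
  have hIw : I * w = w * j := by
    have : (I + j) * I = j * (I + j) := by rw [mul_add, add_mul, hI, hjj, add_comm]
    calc I * w = w * ((I + j) * I) * w := by rw [← mul_assoc, wu, one_mul]
      _ = w * j := by rw [this, mul_assoc, mul_assoc, uw, mul_one]
  have hanti : w * (j - I) * j = -(j * (w * (j - I))) := by
    rw [← mul_assoc j, ← hwI, mul_assoc, mul_assoc, ← mul_neg]
    congr 1
    rw [sub_mul, mul_sub, hjj, hI]
    abel
  have hcoord : (coord I).toReal = w * (j - I) := by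
    rw [coord, ← hu, Ring.inverse_unit]
    exact toReal_antiPart hanti
  have h1 : 1 + (coord I).toReal = (2 : ℝ) • (w * j) := by
    rw [hcoord]
    nth_rewrite 1 [← wu]
    rw [← mul_add, two_smul, ← mul_add]
    congr 1
    abel
  rw [h1]
  refine ⟨⟨⟨(2 : ℝ) • (w * j), (1 / 2 : ℝ) • (-j * (I + j)), ?_, ?_⟩, rfl⟩, ?_⟩
  · rw [smul_mul_smul_comm, mul_assoc w, ← mul_assoc j, mul_neg, hjj, neg_neg, one_mul, wu]
    norm_num
  · rw [smul_mul_smul_comm, mul_assoc (-j), ← mul_assoc (I + j), uw, one_mul, neg_mul, hjj,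
      neg_neg]
    norm_num
  · rw [mul_smul_comm, smul_mul_assoc, ← mul_assoc, hIw]

/-- Characterization of the coordinate. -/
lemma coord_eq {I : REnd V} (hu : IsUnit (I + stdJ V)) {X : Anti V}
    (h : I * (1 + X.toReal) = (1 + X.toReal) * stdJ V) : coord I = X := by
  obtain ⟨u, hu⟩ := hu
  have h1 : (I + stdJ V) * X.toReal = stdJ V - I := by
    rw [mul_add, add_mul, mul_one, one_mul, toReal_mul_stdJ] at h
    rw [add_mul]
    have e : I * X.toReal = stdJ V + -(stdJ V * X.toReal) - I := eq_sub_of_add_eq' h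
    rw [e]
    abel
  rw [coord, ← h1, ← hu, Ring.inverse_unit, Units.inv_mul_cancel_left, antiPart_toReal]

/-- The base point is conjugated by `1 + X` to a point whose sum with `i` is invertible. -/
lemma isUnit_add (X : Anti V) (u : (REnd V)ˣ) (hu : (u : REnd V) = 1 + X.toReal) :
    IsUnit ((u : REnd V) * stdJ V * ((u⁻¹ : (REnd V)ˣ) : REnd V) + stdJ V) := by
  have h1 : (u : REnd V) * stdJ V * ((u⁻¹ : (REnd V)ˣ) : REnd V) + stdJ V
      = ((2 : ℝ) • stdJ V) * ((u⁻¹ : (REnd V)ˣ) : REnd V) := by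
    rw [Units.eq_mul_inv_iff_mul_eq, add_mul, Units.inv_mul_cancel_right, hu, add_mul, mul_add,
      toReal_mul_stdJ, two_smul, one_mul, mul_one]
    abel
  rw [h1]
  refine IsUnit.mul ⟨⟨(2 : ℝ) • stdJ V, (-(1 / 2) : ℝ) • stdJ V, ?_, ?_⟩, rfl⟩ (Units.isUnit _)
  · rw [smul_mul_smul_comm, stdJ_mul_self]; norm_num
  · rw [smul_mul_smul_comm, stdJ_mul_self]; norm_num


/-- The complex-linear part of a real-linear map. -/
lemma exists_linPart (T : REnd V) : ∃ a : V →L[ℂ] V, ∀ x, T x = a x + antiPart T x := by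
  have hT : ∀ (r : ℝ) (y : V), T ((r : ℂ) • y) = (r : ℂ) • T y := fun r y => by simp
  have hC : ∀ (r s : ℝ) (x : V), T (((r : ℂ) + s * Complex.I) • x)
      = (r : ℂ) • T x + (s : ℂ) • T (Complex.I • x) :=
    fun r s x => by
      rw [← hT, ← hT, ← map_add, smul_smul, ← add_smul]
  refine ⟨{ toFun := fun x => T x - antiPart T x, map_add' := ?_, map_smul' := ?_,
            cont := by fun_prop }, fun x => (sub_add_cancel (T x) (antiPart T x)).symm⟩
  · intro x y
    simp only [map_add]
    abel
  · intro c x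
    have h1 : T (Complex.I • Complex.I • x) = -T x := by simp [smul_smul]
    have h2 : ∀ y, antiPart T y = (1 / 2 : ℂ) • (T y + Complex.I • T (Complex.I • y)) :=
      fun y => rfl
    obtain ⟨r, s, rfl⟩ : ∃ r s : ℝ, c = r + s * Complex.I := ⟨_, _, (Complex.re_add_im c).symm⟩
    rw [h2, h2, smul_comm Complex.I _ x, hC r s x, hC r s (Complex.I • x), h1]
    simp only [RingHom.id_apply]
    match_scalars <;>
      first
        | ring1
        | linear_combination (s / 2 : ℂ) * Complex.I_sq

/-- An endomorphism with negative scalar square lies in `GL⁺(V_ℝ)`. -/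
lemma exists_GLPlus {M : REnd V} {t : ℝ} (ht : 0 < t) (h : M * M = -(t • (1 : REnd V))) :
    ∃ g ∈ GLPlus V, (g : REnd V) = M := by
  have hinv : M * (-(t⁻¹) • M) = 1 ∧ (-(t⁻¹) • M) * M = 1 := by
    constructor
    · rw [mul_smul_comm, h, smul_neg, neg_smul, neg_neg, smul_smul, inv_mul_cancel₀ ht.ne', one_smul]
    · rw [smul_mul_assoc, h, smul_neg, neg_smul, neg_neg, smul_smul, inv_mul_cancel₀ ht.ne', one_smul]
  refine ⟨⟨M, -(t⁻¹) • M, hinv.1, hinv.2⟩, ?_, rfl⟩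
  show 0 < M.det
  have h0 : M.det ≠ 0 := fun h0 => by
    have h1 := det_mul M (-(t⁻¹) • M)
    have h2 : (1 : REnd V).det = 1 := LinearMap.det_id
    rw [hinv.1, h2, h0, zero_mul] at h1
    exact one_ne_zero h1
  set s := Real.sqrt t with hs
  have hs0 : 0 < s := Real.sqrt_pos.2 ht
  have hst : s * s = t := Real.mul_self_sqrt ht.le
  have h3 : (M + s • 1) * (M + s • 1) = (2 * s) • M := by
    rw [add_mul, mul_add, mul_add, h, mul_smul_comm, smul_mul_assoc, smul_mul_smul_comm, hst,
      mul_one, one_mul, mul_one, two_mul, add_smul]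
    abel
  have h4 : ((2 * s) • M).det = (2 * s) ^ Module.finrank ℝ V * M.det := by
    show LinearMap.det (((2 * s) • M : REnd V) : V →ₗ[ℝ] V) = _
    rw [ContinuousLinearMap.toLinearMap_smul, LinearMap.det_smul]
  have h5 := det_mul (M + s • 1) (M + s • 1)
  rw [h3, h4] at h5
  have h6 : 0 ≤ (2 * s) ^ Module.finrank ℝ V * M.det := h5 ▸ mul_self_nonneg _
  exact lt_of_le_of_ne (nonneg_of_mul_nonneg_right h6 (by positivity)) (Ne.symm h0)

variable (V) in
/-- A quaternionic structure on `V_ℝ`: a period `I` and a complex structure `J` anticommuting with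
it. The third complex structure is `K = IJ`. -/
structure QuaternionicPair where
  I : REnd V
  J : REnd V
  I_mem : I ∈ Compl V
  J_sq : J * J = -1
  anticomm : I * J = -(J * I)

namespace QuaternionicPair

variable (q : QuaternionicPair V)

/-- The combination `aI + bJ + cK`. -/
def comb (a b c : ℝ) : REnd V := a • q.I + b • q.J + c • (q.I * q.J)

lemma comb_mem {a b c : ℝ} (h : a ^ 2 + b ^ 2 + c ^ 2 = 1) : q.comb a b c ∈ Compl V := by
  have hII := Compl.sq q.I_mem
  have hJJ := q.J_sq
  have hJI : q.J * q.I = -(q.I * q.J) := by rw [q.anticomm, neg_neg]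
  have e1 : q.I * (q.I * q.J) = -q.J := by rw [← mul_assoc, hII, neg_one_mul]
  have e2 : q.I * q.J * q.I = q.J := by
    rw [mul_assoc, hJI, mul_neg, e1, neg_neg]
  have e3 : q.J * (q.I * q.J) = q.I := by
    rw [← mul_assoc, hJI, neg_mul, mul_assoc, hJJ, mul_neg, mul_one, neg_neg]
  have e4 : q.I * q.J * q.J = -q.I := by rw [mul_assoc, hJJ, mul_neg, mul_one]
  have e5 : q.I * q.J * (q.I * q.J) = -1 := by rw [← mul_assoc, e2, hJJ]
  have hsq : q.comb a b c * q.comb a b c = -1 := by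
    have : (-1 : REnd V) = (-(a ^ 2 + b ^ 2 + c ^ 2)) • (1 : REnd V) := by rw [h]; simp
    rw [this]
    simp only [comb, add_mul, mul_add, smul_mul_smul_comm, hII, hJJ, e1, e2, e3, e4, e5, hJI]
    module
  have hIc : q.I * q.comb a b c + q.comb a b c * q.I = (-(2 * a)) • (1 : REnd V) := by
    simp only [comb, add_mul, mul_add, smul_mul_assoc, mul_smul_comm, hII, e1, e2, hJI]
    module
  have ha : -1 ≤ a := by nlinarith [sq_nonneg b, sq_nonneg c]
  obtain ha | ha := ha.lt_or_eq
  · -- conjugate by `I + λ`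
    have h1 : (q.I + q.comb a b c) * (q.I + q.comb a b c) = -((2 + 2 * a) • (1 : REnd V)) := by
      have : (q.I + q.comb a b c) * (q.I + q.comb a b c)
          = q.I * q.I + q.comb a b c * q.comb a b c
            + (q.I * q.comb a b c + q.comb a b c * q.I) := by
        rw [add_mul, mul_add, mul_add]
        abel
      rw [this, hII, hsq, hIc]
      module
    obtain ⟨g, hg, hgM⟩ := exists_GLPlus (by linarith) h1
    have h2 : q.comb a b c = (g : REnd V) * q.I * ((g⁻¹ : (REnd V)ˣ) : REnd V) := by
      rw [Units.eq_mul_inv_iff_mul_eq, hgM, add_mul, mul_add, hII, hsq, add_comm]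
    rw [h2]
    exact Compl.conj_mem q.I_mem hg
  · -- `λ = -I` is conjugate to `I` by `J`
    have hb : b = 0 := by nlinarith [sq_nonneg b, sq_nonneg c]
    have hc : c = 0 := by nlinarith [sq_nonneg b, sq_nonneg c]
    obtain ⟨g, hg, hgM⟩ := exists_GLPlus (M := q.J) (t := 1) one_pos (by rw [one_smul, hJJ])
    have h2 : q.comb a b c = (g : REnd V) * q.I * ((g⁻¹ : (REnd V)ˣ) : REnd V) := by
      rw [Units.eq_mul_inv_iff_mul_eq, hgM, hJI, hb, hc, ← ha]
      simp [comb]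
    rw [h2]
    exact Compl.conj_mem q.I_mem hg

/-- The parametrization `(a, b, c) ↦ aI + bJ + cK` of the twistor sphere by the unit sphere `S²`
of Euclidean 3-space. -/
def sphereMap (p : Metric.sphere (0 : EuclideanSpace ℝ (Fin 3)) 1) : Compl V :=
  ⟨q.comb (p.1 0) (p.1 1) (p.1 2), q.comb_mem (by
    have h := p.2
    rw [mem_sphere_zero_iff_norm, EuclideanSpace.norm_eq, Real.sqrt_eq_one,
      Fin.sum_univ_three] at h
    simpa using h)⟩

end QuaternionicPair

/-- The twistor spheres (twistor lines) in the period domain: the sets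
`{aI + bJ + cK : a² + b² + c² = 1}`. -/
def IsTwistorSphere (S : Set (Compl V)) : Prop :=
  ∃ q : QuaternionicPair V, S = Set.range q.sphereMap

/-- The Néron–Severi group of the complex torus `(V_ℝ, I) / Γ`: the alternating real bilinear forms
on `V_ℝ` that are integral on `Γ` (the classes in `H²(V/Γ, ℤ)`) and of Hodge type `(1,1)`, i.e.
invariant under `I`. -/
def neronSeveri (Γ : Submodule ℤ V) (I : Compl V) : AddSubgroup (LinearMap.BilinForm ℝ V) where
  carrier := {Ω | Ω.IsAlt ∧ (∀ x ∈ Γ, ∀ y ∈ Γ, ∃ k : ℤ, Ω x y = k) ∧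
    ∀ x y, Ω ((I : REnd V) x) ((I : REnd V) y) = Ω x y}
  add_mem' := by
    rintro Ω Ω' ⟨h1, h2, h3⟩ ⟨h1', h2', h3'⟩
    refine ⟨h1.add h1', fun x hx y hy => ?_, fun x y => by simp [h3, h3']⟩
    obtain ⟨k, hk⟩ := h2 x hx y hy
    obtain ⟨k', hk'⟩ := h2' x hx y hy
    exact ⟨k + k', by simp [hk, hk']⟩
  zero_mem' := ⟨LinearMap.BilinForm.isAlt_zero, fun _ _ _ _ => ⟨0, by simp⟩, fun _ _ => by simp⟩
  neg_mem' := by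
    rintro Ω ⟨h1, h2, h3⟩
    refine ⟨h1.neg, fun x hx y hy => ?_, fun x y => by simp [h3]⟩
    obtain ⟨k, hk⟩ := h2 x hx y hy
    exact ⟨-k, by simp [hk]⟩

/-- A period is generic if the corresponding torus has trivial Néron–Severi group. -/
def IsGeneric (Γ : Submodule ℤ V) (I : Compl V) : Prop := neronSeveri Γ I = ⊥

/-- `P` and `Q` are joined by a generic chain of twistor lines: twistor spheres `S₀, …, S_m` with
`P ∈ S₀` and `Q ∈ S_m` such that successive ones meet and meet only in generic periods. -/
def JoinedByGenericChain (Γ : Submodule ℤ V) (P Q : Compl V) : Prop :=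
  ∃ (m : ℕ) (S : Fin (m + 1) → Set (Compl V)),
    (∀ k, IsTwistorSphere (S k)) ∧ P ∈ S 0 ∧ Q ∈ S (Fin.last m) ∧
    ∀ k : Fin m, (S k.castSucc ∩ S k.succ).Nonempty ∧
      ∀ T ∈ S k.castSucc ∩ S k.succ, IsGeneric Γ T

section FiniteDim

variable [FiniteDimensional ℂ V]

/-- An element of positive determinant is invertible. -/
lemma isUnit_of_det_pos {T : REnd V} (h : 0 < T.det) : IsUnit T := by
  have h1 : IsUnit (LinearMap.det (T : V →ₗ[ℝ] V)) := isUnit_iff_ne_zero.2 h.ne'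
  refine ⟨ContinuousLinearEquiv.toUnit (T.toContinuousLinearEquivOfDetNeZero h.ne'), ?_⟩
  ext x
  rfl

/-- A complex-linear automorphism has positive real determinant. -/
lemma det_pos_of_commute {C : REnd V} (hC : IsUnit C) (h : C * stdJ V = stdJ V * C) :
    0 < C.det := by
  let L : V →ₗ[ℂ] V :=
    { toFun := C
      map_add' := C.map_add
      map_smul' := fun c x => by
        have h1 : C (Complex.I • x) = Complex.I • C x := by
          simpa [stdJ] using congrArg (fun S : REnd V => S x) h
        have e1 : ∀ y : V, c • y = c.re • y + c.im • (Complex.I • y) := fun y => by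
          rw [← Complex.coe_smul, ← Complex.coe_smul, smul_smul, ← add_smul, Complex.re_add_im]
        simp only [RingHom.id_apply]
        rw [e1 x, e1 (C x), map_add, map_smul, map_smul, h1] }
  have h2 : C.det = Algebra.norm ℝ (LinearMap.det L) := by
    rw [← LinearMap.det_restrictScalars]
    rfl
  have h3 : C.det ≠ 0 := by
    obtain ⟨u, rfl⟩ := hC
    intro h0
    have h4 := det_mul (u : REnd V) ((u⁻¹ : (REnd V)ˣ) : REnd V)
    rw [Units.mul_inv, h0, zero_mul] at h4
    have h5 : (1 : REnd V).det = 1 := LinearMap.det_id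
    rw [h5] at h4
    exact one_ne_zero h4
  rw [h2, Algebra.norm_complex_apply] at h3 ⊢
  exact lt_of_le_of_ne (Complex.normSq_nonneg _) (Ne.symm h3)

lemma det_pos_coord {I : REnd V} (hI : I ∈ Compl V) (hu : IsUnit (I + stdJ V)) :
    0 < (1 + (coord I).toReal).det := by
  obtain ⟨⟨u, h1⟩, h2⟩ := coord_spec (Compl.sq hI) hu
  obtain ⟨g, hg, rfl⟩ := hI
  rw [← h1] at h2 ⊢
  have h3 : 0 < (((g⁻¹ : (REnd V)ˣ) : REnd V) * (u : REnd V)).det := by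
    refine det_pos_of_commute (IsUnit.mul (Units.isUnit _) (Units.isUnit _)) ?_
    rw [mul_assoc, ← h2]
    simp only [← mul_assoc, Units.inv_mul, one_mul]
  have h4 : (u : REnd V) = g * (((g⁻¹ : (REnd V)ˣ) : REnd V) * (u : REnd V)) := by
    rw [Units.mul_inv_cancel_left]
  rw [h4, det_mul]
  exact mul_pos hg h3

variable (V) in
/-- The chart of the period domain around its base point. -/
def baseChart : OpenPartialHomeomorph (Compl V) (Anti V) where
  toFun I := coord (I : REnd V)
  invFun X :=
    open Classical in
    if h : 0 < (1 + X.toReal).det then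
      ⟨((isUnit_of_det_pos h).unit : REnd V) * stdJ V
          * (((isUnit_of_det_pos h).unit⁻¹ : (REnd V)ˣ) : REnd V),
        ⟨(isUnit_of_det_pos h).unit, h, rfl⟩⟩
    else ⟨stdJ V, stdJ_mem V⟩
  source := {I | IsUnit ((I : REnd V) + stdJ V)}
  target := {X | 0 < (1 + X.toReal).det}
  map_source' := by
    rintro ⟨I, hI⟩ (hu : IsUnit (I + stdJ V))
    exact det_pos_coord hI hu
  map_target' := by
    intro X (hX : 0 < (1 + X.toReal).det)
    rw [dif_pos hX]
    exact isUnit_add X _ rfl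
  left_inv' := by
    rintro ⟨I, hI⟩ (hu : IsUnit (I + stdJ V))
    rw [dif_pos (det_pos_coord hI hu)]
    apply Subtype.ext
    show _ * _ * _ = I
    rw [Units.mul_inv_eq_iff_eq_mul]
    exact (coord_spec (Compl.sq hI) hu).2.symm
  right_inv' := by
    intro X (hX : 0 < (1 + X.toReal).det)
    rw [dif_pos hX]
    refine coord_eq (isUnit_add X _ rfl) ?_
    show ((isUnit_of_det_pos hX).unit : REnd V) * stdJ V
          * (((isUnit_of_det_pos hX).unit⁻¹ : (REnd V)ˣ) : REnd V)
          * ((isUnit_of_det_pos hX).unit : REnd V) = _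
    rw [Units.inv_mul_cancel_right]
    rfl
  open_source := by
    have : CompleteSpace V := FiniteDimensional.complete ℂ V
    exact Units.isOpen.preimage (continuous_subtype_val.add continuous_const)
  open_target := isOpen_lt continuous_const
    (ContinuousLinearMap.continuous_det.comp (continuous_const.add continuous_toReal))
  continuousOn_toFun := by
    have : CompleteSpace V := FiniteDimensional.complete ℂ V
    rintro ⟨I, hI⟩ (hu : IsUnit (I + stdJ V))
    obtain ⟨u, hu⟩ := hu
    refine ContinuousAt.continuousWithinAt ?_
    refine continuous_antiPart.continuousAt.comp (ContinuousAt.mul ?_ (by fun_prop))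
    refine ContinuousAt.comp (g := Ring.inverse) ?_ (by fun_prop)
    show ContinuousAt Ring.inverse (I + stdJ V)
    rw [← hu]
    exact NormedRing.inverse_continuousAt u
  continuousOn_invFun := by
    have : CompleteSpace V := FiniteDimensional.complete ℂ V
    rw [continuousOn_iff_continuous_domRestrict]
    refine Continuous.subtype_mk (f := fun X : {X : Anti V | 0 < (1 + X.toReal).det} =>
      (1 + X.1.toReal) * stdJ V * Ring.inverse (1 + X.1.toReal)) ?_
      (fun X => ?_) |>.congr ?_
    · refine Continuous.mul ((continuous_const.add
        (continuous_toReal.comp continuous_subtype_val)).mul continuous_const) ?_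
      rw [continuous_iff_continuousAt]
      rintro ⟨X, hX⟩
      refine ContinuousAt.comp (g := Ring.inverse) ?_
        (continuous_const.add (continuous_toReal.comp continuous_subtype_val)).continuousAt
      obtain ⟨u, hu⟩ := isUnit_of_det_pos hX
      show ContinuousAt Ring.inverse (1 + X.toReal)
      rw [← hu]
      exact NormedRing.inverse_continuousAt u
    · obtain ⟨u, hu⟩ := isUnit_of_det_pos X.2
      refine ⟨u, ?_, ?_⟩
      · show 0 < (u : REnd V).det
        rw [hu]
        exact X.2
      · rw [← hu, Ring.inverse_unit]
    · rintro ⟨X, hX⟩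
      apply Subtype.ext
      have hX' : 0 < (1 + X.toReal).det := hX
      have h1 : Ring.inverse (1 + X.toReal)
          = (((isUnit_of_det_pos hX').unit⁻¹ : (REnd V)ˣ) : REnd V) :=
        Ring.inverse_unit (isUnit_of_det_pos hX').unit
      simp only [Set.domRestrict_apply, dif_pos hX', h1]
      rfl

/-- Conjugation by an element of `GL⁺(V_ℝ)`. -/
def conjHomeo (g : GLPlus V) : Compl V ≃ₜ Compl V where
  toFun I := ⟨_, Compl.conj_mem I.2 g.2⟩
  invFun I := ⟨_, Compl.conj_mem I.2 (g⁻¹).2⟩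
  left_inv I := Subtype.ext (by simp [mul_assoc])
  right_inv I := Subtype.ext (by simp [mul_assoc])
  continuous_toFun := by fun_prop
  continuous_invFun := by fun_prop

/-- The chart centred at `g i g⁻¹`: conjugate by `g⁻¹`, then apply the chart at the base point. -/
def chart (g : GLPlus V) : OpenPartialHomeomorph (Compl V) (Anti V) :=
  (conjHomeo g⁻¹).toOpenPartialHomeomorph.trans (baseChart V)

/-- The atlas of all translates of the base chart. -/
instance : ChartedSpace (Anti V) (Compl V) where
  atlas := Set.range chart
  chartAt I := chart ⟨I.2.choose, I.2.choose_spec.1⟩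
  mem_chart_source I := by
    have h := I.2.choose_spec.2
    refine ⟨trivial, ?_⟩
    show IsUnit (((_⁻¹ : (REnd V)ˣ) : REnd V) * (I : REnd V) * _ + stdJ V)
    have h1 : ((I.2.choose⁻¹ : (REnd V)ˣ) : REnd V) * (I : REnd V)
        * ((I.2.choose⁻¹⁻¹ : (REnd V)ˣ) : REnd V) = stdJ V := by
      nth_rewrite 2 [h]
      simp [mul_assoc]
    have h2 := isUnit_add (0 : Anti V) 1 (by ext x; simp [Anti.toReal])
    convert h2 using 2
    rw [inv_one, Units.val_one, one_mul, mul_one]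
    exact h1
  chart_mem_atlas I := ⟨_, rfl⟩


variable (V) in
/-- A conjugation of `V`. -/
lemma exists_conj : ∃ c : Anti V, ∀ x, c (c x) = x := by
  let b := Module.finBasis ℂ V
  let f : V →ₗ[ℝ] V :=
    { toFun := fun x => ∑ i, conj (b.repr x i) • b i
      map_add' := fun x y => by simp [add_smul, Finset.sum_add_distrib]
      map_smul' := fun r x => by
        rw [← Complex.coe_smul, map_smul]
        simp [Finset.smul_sum, mul_smul] }
  refine ⟨{ toFun := f, map_add' := f.map_add, map_smul' := fun r x => ?_,
            cont := f.continuous_of_finiteDimensional }, fun x => ?_⟩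
  · show ∑ i, conj (b.repr (r • x) i) • b i = conj r • ∑ i, conj (b.repr x i) • b i
    simp [Finset.smul_sum, mul_smul]
  · show ∑ i, conj (b.repr (∑ k, conj (b.repr x k) • b k) i) • b i = x
    have : ∀ i, b.repr (∑ k, conj (b.repr x k) • b k) i = conj (b.repr x i) := fun i => by
      rw [b.repr_sum_self]
    simp only [this, Complex.conj_conj]
    exact b.sum_repr x

/-- In two charts, the identity is a Möbius transformation with operator coefficients, hence
holomorphic. -/
lemma contDiffOn_transition (k : (REnd V)ˣ) :
    ContDiffOn ℂ ω (fun X : Anti V => coord ((k : REnd V) * ((1 + X.toReal) * stdJ V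
        * Ring.inverse (1 + X.toReal)) * ((k⁻¹ : (REnd V)ˣ) : REnd V)))
      {X | IsUnit (1 + X.toReal) ∧ IsUnit ((k : REnd V) * ((1 + X.toReal) * stdJ V
        * Ring.inverse (1 + X.toReal)) * ((k⁻¹ : (REnd V)ˣ) : REnd V) + stdJ V)} := by
  have : CompleteSpace V := FiniteDimensional.complete ℂ V
  obtain ⟨c, hc⟩ := exists_conj V
  obtain ⟨a, ha⟩ := exists_linPart (k : REnd V)
  set b : Anti V := antiPart (k : REnd V) with hb
  let p : Anti V →L[ℂ] (V →L[ℂ] V) :=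
    (ContinuousLinearMap.compSL V V V (starRingEnd ℂ) (starRingEnd ℂ)).flip c
  let q : (V →L[ℂ] V) →L[ℂ] Anti V :=
    (ContinuousLinearMap.compSL V V V (starRingEnd ℂ) (RingHom.id ℂ)).flip c
  have hp : ∀ X x, p X x = X (c x) := fun X x => rfl
  have hq : ∀ X x, q X x = X (c x) := fun X x => rfl
  let D : Anti V → (V →L[ℂ] V) := fun X => c.comp (a.comp c) + (c.comp b : V →L[ℂ] V) * p X
  let N : Anti V → (V →L[ℂ] V) := fun X => p b + a * p X
  have hDc : ∀ X x, D X (c x) = c (a x + b (X x)) := fun X x => by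
    simp [D, hp, hc]
  have hNc : ∀ X x, N X (c x) = b x + a (X x) := fun X x => by
    simp [N, hp, hc]
  have hD : ContDiff ℂ ω D := contDiff_const.add (contDiff_const.mul p.contDiff)
  have hN : ContDiff ℂ ω N := contDiff_const.add (contDiff_const.mul p.contDiff)
  -- the two facts about points of the domain
  have main : ∀ X : Anti V, IsUnit (1 + X.toReal) →
      IsUnit ((k : REnd V) * ((1 + X.toReal) * stdJ V
        * Ring.inverse (1 + X.toReal)) * ((k⁻¹ : (REnd V)ˣ) : REnd V) + stdJ V) →
      IsUnit (D X) ∧ coord ((k : REnd V) * ((1 + X.toReal) * stdJ V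
        * Ring.inverse (1 + X.toReal)) * ((k⁻¹ : (REnd V)ˣ) : REnd V))
        = q (N X * Ring.inverse (D X)) := by
    rintro X ⟨u, hu⟩ hI
    rw [← hu, Ring.inverse_unit] at hI ⊢
    set M : (REnd V)ˣ := k * u with hM
    set I : REnd V := (k : REnd V) * ((u : REnd V) * stdJ V * ((u⁻¹ : (REnd V)ˣ) : REnd V))
      * ((k⁻¹ : (REnd V)ˣ) : REnd V) with hIdef
    have hIM : I * (M : REnd V) = M * stdJ V := by
      simp [hIdef, hM, mul_assoc]
    let L : REnd V := a.restrictScalars ℝ + b.toReal * X.toReal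
    have hLx : ∀ x, L x = a x + b (X x) := fun x => rfl
    have hMx : ∀ x, (M : REnd V) x = (a x + b (X x)) + (b x + a (X x)) := fun x => by
      rw [hM, Units.val_mul, hu]
      show (k : REnd V) (x + X x) = _
      rw [ha, map_add, map_add]
      abel
    have hLj : L * stdJ V = stdJ V * L := by
      ext x
      simp [stdJ, hLx]
    have h2 : (I + stdJ V) * (M : REnd V) = ((2 : ℝ) • stdJ V) * L := by
      rw [add_mul, hIM]
      ext x
      show (M : REnd V) (Complex.I • x) + Complex.I • (M : REnd V) x
        = (2 : ℝ) • Complex.I • L x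
      rw [hMx, hMx, hLx, ← Complex.coe_smul]
      simp only [map_smul, ContinuousLinearMap.map_smulₛₗ, Complex.conj_I, map_neg,
        neg_smul, neg_neg]
      push_cast
      module
    have h2u : IsUnit ((2 : ℝ) • stdJ V) :=
      ⟨⟨(2 : ℝ) • stdJ V, (-(1 / 2) : ℝ) • stdJ V,
        by rw [smul_mul_smul_comm, stdJ_mul_self]; norm_num,
        by rw [smul_mul_smul_comm, stdJ_mul_self]; norm_num⟩, rfl⟩
    have hLu : IsUnit L := by
      have h3 : IsUnit (((2 : ℝ) • stdJ V) * L) := h2 ▸ hI.mul M.isUnit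
      obtain ⟨v, hv⟩ := h2u
      rw [← hv] at h3
      exact (Units.isUnit_units_mul v L).1 h3
    have hLbij : Function.Bijective L := ContinuousLinearMap.isUnit_iff_bijective.1 hLu
    have hcbij : Function.Bijective c :=
      ⟨Function.LeftInverse.injective hc, Function.RightInverse.surjective hc⟩
    have hDu : IsUnit (D X) := by
      rw [ContinuousLinearMap.isUnit_iff_bijective]
      have h3 : (D X : V → V) = c ∘ L ∘ c := by
        funext x
        have := hDc X (c x)
        rw [hc] at this
        exact this
      rw [h3]
      exact hcbij.comp (hLbij.comp hcbij)
    refine ⟨hDu, coord_eq hI ?_⟩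
    obtain ⟨d, hd⟩ := hDu
    set Y := q (N X * Ring.inverse (D X)) with hY
    have hYL : ∀ x, Y (L x) = b x + a (X x) := fun x => by
      rw [hY, hq, hLx, ← hDc, ← hd, Ring.inverse_unit]
      show N X (((d⁻¹ : (V →L[ℂ] V)ˣ) * (d : V →L[ℂ] V)) (c x)) = _
      rw [Units.inv_mul]
      exact hNc X x
    have hML : (1 + Y.toReal) * L = M := by
      ext x
      show L x + Y (L x) = _
      rw [hYL, hMx, hLx]
    rw [← hML] at hIM
    obtain ⟨l, hl⟩ := hLu
    rw [← hl] at hIM hLj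
    rw [← mul_assoc, mul_assoc _ _ (stdJ V), hLj, ← mul_assoc] at hIM
    exact (Units.mul_left_inj l).1 hIM
  rintro X ⟨hX1, hX2⟩
  obtain ⟨⟨d, hd⟩, -⟩ := main X hX1 hX2
  have hF : ContDiffAt ℂ ω (fun X => q (N X * Ring.inverse (D X))) X := by
    refine q.contDiff.contDiffAt.comp X (hN.contDiffAt.mul ?_)
    refine ContDiffAt.comp (g := Ring.inverse) X ?_ hD.contDiffAt
    rw [← hd]
    exact contDiffAt_ringInverse ℂ d
  exact hF.contDiffWithinAt.congr (fun Z hZ => (main Z hZ.1 hZ.2).2) (main X hX1 hX2).2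

/-- The period domain is a complex manifold. -/
instance : IsManifold 𝓘(ℂ, Anti V) ω (Compl V) := by
  refine isManifold_of_contDiffOn _ _ _ ?_
  rintro _ _ ⟨g, rfl⟩ ⟨h, rfl⟩
  have key : ∀ X : Anti V, 0 < (1 + X.toReal).det →
      (((conjHomeo h⁻¹) ((chart g).symm X) : Compl V) : REnd V)
      = (((h⁻¹ * g : GLPlus V) : (REnd V)ˣ) : REnd V) * ((1 + X.toReal) * stdJ V
        * Ring.inverse (1 + X.toReal)) * (((h⁻¹ * g : GLPlus V)⁻¹ : (REnd V)ˣ) : REnd V) := by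
    intro X hX
    have h1 : Ring.inverse (1 + X.toReal)
          = (((isUnit_of_det_pos hX).unit⁻¹ : (REnd V)ˣ) : REnd V) :=
        Ring.inverse_unit (isUnit_of_det_pos hX).unit
    have h2 : (((baseChart V).symm X : Compl V) : REnd V)
        = (1 + X.toReal) * stdJ V * Ring.inverse (1 + X.toReal) := by
      show (((baseChart V).invFun X : Compl V) : REnd V) = _
      simp only [baseChart, dif_pos hX, h1]
      rfl
    show (((h⁻¹ : GLPlus V) : (REnd V)ˣ) : REnd V)
      * ((((g⁻¹⁻¹ : GLPlus V) : (REnd V)ˣ) : REnd V) * (((baseChart V).symm X : Compl V) : REnd V)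
          * ((((g⁻¹⁻¹ : GLPlus V) : (REnd V)ˣ)⁻¹ : (REnd V)ˣ) : REnd V))
      * ((((h⁻¹ : GLPlus V) : (REnd V)ˣ)⁻¹ : (REnd V)ˣ) : REnd V) = _
    rw [h2]
    simp [mul_assoc]
  refine ((contDiffOn_transition (V := V) ((h⁻¹ * g : GLPlus V) : (REnd V)ˣ)).mono ?_).congr ?_
  · intro X hX
    obtain ⟨⟨hX1, hX2⟩, -⟩ := hX
    have hX3 : 0 < (1 + X.toReal).det := hX1.1
    refine ⟨isUnit_of_det_pos hX3, ?_⟩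
    have h3 : IsUnit ((((conjHomeo h⁻¹) ((chart g).symm X) : Compl V) : REnd V) + stdJ V) := hX2.2
    rw [key X hX3] at h3
    exact h3
  · intro X hX
    have hX3 : 0 < (1 + X.toReal).det := hX.1.1.1
    show coord (((conjHomeo h⁻¹) ((chart g).symm X) : Compl V) : REnd V) = _
    rw [key X hX3]

end FiniteDim
end TwistorPath
end

/-!
Embedding of twistor spheres. Conjugating by `GL⁺(V_ℝ)`, let `I` be the base point `i`. Then `J` is
conjugate-linear, and conjugation of `i` by `1 + zJ`, `z ∈ ℂ`, reaches every point of the sphere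
`S(I, J)` but `-I`. So in the chart of the period domain centred at `I` the sphere minus a point is
the complex line spanned by `J`, and the line coordinate is `i` times stereographic projection
(`QuaternionicPair.coord_comb`). The same holds at `-I`, for the pair `(-I, J)`. With the two
stereographic charts `z` and `1 / z` the sphere is a Riemann surface, and the map into the period
domain, being linear in charts, is an immersion; it is an embedding since the sphere is compact.

Generic chains. Two anticommuting complex structures lie on a common twistor sphere, so it suffices
to join periods by sequences of complex structures in which consecutive terms anticommute and the
inner terms are generic. Two twistor spheres that share a period `M` either coincide or meet in
`±M` only (`IsTwistorSphere.eq_of_mem`), so the spheres along such a sequence, repetitions dropped,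
form a generic chain.

If complex structures `A` and `B` nearly anticommute, the phase of the commutator `[A, B]`, in the
sense of polar decomposition, is a complex structure anticommuting with both, and it is the only
one near `AB` (`eventually_third`, `eventually_eq_third`). For `P` and `Q` close to `I`, consider
the space of pairs `(J₁, J₂)` close to `(J, JI)` such that consecutive terms of `P, J₁, J₂, Q`
anticommute. It is nonempty, locally compact, and either term is a continuous function of the other
one; so `J₁` can be moved freely among the complex structures anticommuting with `P`, and `J₂`
among those anticommuting with `Q`. A nonzero form is never preserved by all complex structures
near `J` that anticommute with `I`: differentiating in the directions `IJE`, with `E` commuting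
with `I` and `J`, one finds that every such `E` with `E² = -1` is self-adjoint for the form, which
is impossible because the commutant of `I` and `J` contains a copy of the quaternions
(`not_eventually_preserves`). There are countably many integral forms, so Baire's theorem provides
a pair `(J₁, J₂)` of generic periods (`eventually_exists_anticommuting_chain`).

Hence nearby periods are joined by generic chains, generic periods are dense, and any two periods
are joined because the period domain is connected, which is the connectedness of `GL⁺(V_ℝ)`.
-/

open scoped Topology
open Filter

noncomputable section

namespace TwistorPath


/-! ### The unit sphere and the algebra of a twistor sphere -/

section

/-- The unit sphere of Euclidean 3-space. -/
abbrev S2 : Type := Metric.sphere (0 : EuclideanSpace ℝ (Fin 3)) 1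

lemma S2.sum_sq (p : S2) : p.1 0 ^ 2 + p.1 1 ^ 2 + p.1 2 ^ 2 = 1 := by
  have h := p.2
  rw [mem_sphere_zero_iff_norm, EuclideanSpace.norm_eq, Real.sqrt_eq_one, Fin.sum_univ_three] at h
  simpa using h

/-- The point of the sphere with given coordinates. -/
def S2.mk (a b c : ℝ) (h : a ^ 2 + b ^ 2 + c ^ 2 = 1) : S2 := ⟨!₂[a, b, c], by
  rw [mem_sphere_zero_iff_norm, EuclideanSpace.norm_eq, Real.sqrt_eq_one, Fin.sum_univ_three]
  simpa using h⟩

lemma S2.ext {p p' : S2} (h0 : p.1 0 = p'.1 0) (h1 : p.1 1 = p'.1 1) (h2 : p.1 2 = p'.1 2) :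
    p = p' := by
  apply Subtype.ext
  ext i
  fin_cases i
  exacts [h0, h1, h2]

lemma S2.one_add_ne {p : S2} (h : p.1 0 ≠ -1) : 1 + p.1 0 ≠ 0 := fun h0 => h (by linarith)

variable {V : Type*} [NormedAddCommGroup V] [NormedSpace ℂ V]

namespace QuaternionicPair

variable (q : QuaternionicPair V)

/-- Multiplication of imaginary quaternions by scalar and cross product. -/
lemma comb_mul_comb (a b c a' b' c' : ℝ) : q.comb a b c * q.comb a' b' c'
    = -((a * a' + b * b' + c * c') • (1 : REnd V))
      + q.comb (b * c' - c * b') (c * a' - a * c') (a * b' - b * a') := by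
  have hII := Compl.sq q.I_mem
  have hJJ := q.J_sq
  have hJI : q.J * q.I = -(q.I * q.J) := by rw [q.anticomm, neg_neg]
  have e1 : q.I * (q.I * q.J) = -q.J := by rw [← mul_assoc, hII, neg_one_mul]
  have e2 : q.I * q.J * q.I = q.J := by rw [mul_assoc, hJI, mul_neg, e1, neg_neg]
  have e3 : q.J * (q.I * q.J) = q.I := by
    rw [← mul_assoc, hJI, neg_mul, mul_assoc, hJJ, mul_neg, mul_one, neg_neg]
  have e4 : q.I * q.J * q.J = -q.I := by rw [mul_assoc, hJJ, mul_neg, mul_one]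
  have e5 : q.I * q.J * (q.I * q.J) = -1 := by rw [← mul_assoc, e2, hJJ]
  simp only [comb, add_mul, mul_add, smul_mul_smul_comm, hII, hJJ, e1, e2, e3, e4, e5, hJI]
  module

lemma comb_mul_self (a b c : ℝ) :
    q.comb a b c * q.comb a b c = -((a ^ 2 + b ^ 2 + c ^ 2) • (1 : REnd V)) := by
  rw [comb_mul_comb]
  simp only [comb]
  module

lemma smul_comb (r a b c : ℝ) : r • q.comb a b c = q.comb (r * a) (r * b) (r * c) := by
  simp only [comb]
  module

lemma comb_add_comb (a b c a' b' c' : ℝ) :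
    q.comb a b c + q.comb a' b' c' = q.comb (a + a') (b + b') (c + c') := by
  simp only [comb]
  module

lemma mem_range_sphereMap {L : Compl V} : L ∈ Set.range q.sphereMap ↔
    ∃ a b c : ℝ, a ^ 2 + b ^ 2 + c ^ 2 = 1 ∧ (L : REnd V) = q.comb a b c := by
  constructor
  · rintro ⟨p, rfl⟩
    exact ⟨p.1 0, p.1 1, p.1 2, S2.sum_sq p, rfl⟩
  · rintro ⟨a, b, c, h, hL⟩
    refine ⟨S2.mk a b c h, Subtype.ext ?_⟩
    rw [hL]
    simp [sphereMap, S2.mk]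

lemma I_mem_range : (⟨q.I, q.I_mem⟩ : Compl V) ∈ Set.range q.sphereMap :=
  q.mem_range_sphereMap.2 ⟨1, 0, 0, by norm_num, by simp [comb]⟩

lemma J_mem : q.J ∈ Compl V := by
  have h := q.comb_mem (a := 0) (b := 1) (c := 0) (by norm_num)
  simpa [comb] using h

lemma J_mem_range : (⟨q.J, q.J_mem⟩ : Compl V) ∈ Set.range q.sphereMap :=
  q.mem_range_sphereMap.2 ⟨0, 1, 0, by norm_num, by simp [comb]⟩

/-- A twistor sphere is determined by two of its points that are neither equal nor opposite: these
points and their commutator span the imaginary quaternions. -/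
lemma mem_range_iff_of_mem [Nontrivial V] {M T : Compl V} (hM : M ∈ Set.range q.sphereMap)
    (hT : T ∈ Set.range q.sphereMap) (h1 : T ≠ M) (h2 : (T : REnd V) ≠ -M) (L : Compl V) :
    L ∈ Set.range q.sphereMap ↔ ∃ α β γ : ℝ, (L : REnd V)
      = α • (M : REnd V) + β • (T : REnd V) + γ • ((M : REnd V) * T - T * M) := by
  obtain ⟨a, b, c, hm, hM⟩ := q.mem_range_sphereMap.1 hM
  obtain ⟨x, y, z, ht, hT⟩ := q.mem_range_sphereMap.1 hT
  have hcomm : (M : REnd V) * T - T * M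
      = q.comb (2 * (b * z - c * y)) (2 * (c * x - a * z)) (2 * (a * y - b * x)) := by
    rw [hM, hT, comb_mul_comb, comb_mul_comb]
    simp only [comb]
    module
  rw [hcomm, hM, hT]
  constructor
  · intro hL
    obtain ⟨u, v, w, -, hL⟩ := q.mem_range_sphereMap.1 hL
    -- `N` is the squared length of the cross product; if it vanishes, `T = ±M`
    set N : ℝ := (b * z - c * y) ^ 2 + (c * x - a * z) ^ 2 + (a * y - b * x) ^ 2 with hN
    have hN0 : N ≠ 0 := by
      intro h0
      have q1 := sq_nonneg (b * z - c * y)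
      have q2 := sq_nonneg (c * x - a * z)
      have q3 := sq_nonneg (a * y - b * x)
      have e1 : b * z - c * y = 0 := by nlinarith only [h0, hN, q1, q2, q3]
      have e2 : c * x - a * z = 0 := by nlinarith only [h0, hN, q1, q2, q3]
      have e3 : a * y - b * x = 0 := by nlinarith only [h0, hN, q1, q2, q3]
      set d := a * x + b * y + c * z with hd
      have hx : x = d * a := by linear_combination (-x) * hm + c * e2 - b * e3
      have hy : y = d * b := by linear_combination (-y) * hm - c * e1 + a * e3
      have hz : z = d * c := by linear_combination (-z) * hm + b * e1 - a * e2
      have hd2 : (d - 1) * (d + 1) = 0 := by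
        rw [hx, hy, hz] at ht
        linear_combination ht - d ^ 2 * hm
      rcases mul_eq_zero.1 hd2 with hd1 | hd1
      · apply h1
        apply Subtype.ext
        have : d = 1 := by linarith
        rw [hM, hT, hx, hy, hz, this, one_mul, one_mul, one_mul]
      · apply h2
        have : d = -1 := by linarith
        rw [hM, hT, hx, hy, hz, this]
        simp only [comb]
        module
    -- the coordinates are scalar products with the basis dual to `m, t, m × t`
    set n₁ := b * z - c * y
    set n₂ := c * x - a * z
    set n₃ := a * y - b * x
    refine ⟨(u * (y * n₃ - z * n₂) + v * (z * n₁ - x * n₃) + w * (x * n₂ - y * n₁)) / N,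
      (u * (n₂ * c - n₃ * b) + v * (n₃ * a - n₁ * c) + w * (n₁ * b - n₂ * a)) / N,
      (u * n₁ + v * n₂ + w * n₃) / (2 * N), ?_⟩
    rw [hL, smul_comb, smul_comb, smul_comb, comb_add_comb, comb_add_comb]
    congr 1 <;> field_simp <;> simp only [hN, n₁, n₂, n₃] <;> ring
  · rintro ⟨α, β, γ, hL⟩
    rw [smul_comb, smul_comb, smul_comb, comb_add_comb, comb_add_comb] at hL
    refine q.mem_range_sphereMap.2 ⟨_, _, _, ?_, hL⟩
    have h3 := Compl.sq L.2
    rw [hL, comb_mul_self, neg_inj] at h3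
    have h4 : ∀ r : ℝ, r • (1 : REnd V) = 1 → r = 1 := fun r hr => by
      have h5 : (r - 1) • (1 : REnd V) = 0 := by rw [sub_smul, hr, one_smul, sub_self]
      have := (smul_eq_zero.1 h5).resolve_right one_ne_zero
      linarith
    exact h4 _ h3

end QuaternionicPair

end

/-! ### The Riemann sphere and the embedding of a twistor sphere -/

section

section Sphere

/-- Stereographic projection `(a, b, c) ↦ (b + ic) / (1 + a)`. -/
def stereo : OpenPartialHomeomorph S2 ℂ where
  toFun p := ⟨p.1 1 / (1 + p.1 0), p.1 2 / (1 + p.1 0)⟩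
  invFun z := S2.mk ((1 - (z.re ^ 2 + z.im ^ 2)) / (1 + (z.re ^ 2 + z.im ^ 2)))
    (2 * z.re / (1 + (z.re ^ 2 + z.im ^ 2))) (2 * z.im / (1 + (z.re ^ 2 + z.im ^ 2))) (by
      have : 1 + (z.re ^ 2 + z.im ^ 2) ≠ 0 := by positivity
      field_simp
      ring)
  source := {p | p.1 0 ≠ -1}
  target := Set.univ
  map_source' _ _ := trivial
  map_target' z _ := by
    have : 1 + (z.re ^ 2 + z.im ^ 2) ≠ 0 := by positivity
    show (1 - (z.re ^ 2 + z.im ^ 2)) / (1 + (z.re ^ 2 + z.im ^ 2)) ≠ -1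
    rw [Ne, div_eq_iff this]
    intro h
    linarith
  left_inv' p hp := by
    have h1 := S2.one_add_ne hp
    have h2 := p.sum_sq
    have h3 : 1 + ((p.1 1 / (1 + p.1 0)) ^ 2 + (p.1 2 / (1 + p.1 0)) ^ 2) = 2 / (1 + p.1 0) := by
      field_simp
      linear_combination h2
    refine S2.ext ?_ ?_ ?_ <;> simp only [S2.mk, h3] <;> simp <;> field_simp
    linear_combination -h2
  right_inv' z _ := by
    have h : 1 + (z.re ^ 2 + z.im ^ 2) ≠ 0 := by positivity
    have h1 : 1 + (1 - (z.re ^ 2 + z.im ^ 2)) / (1 + (z.re ^ 2 + z.im ^ 2))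
        = 2 / (1 + (z.re ^ 2 + z.im ^ 2)) := by
      field_simp
      ring
    apply Complex.ext <;> simp only [S2.mk] <;> simp [h1] <;> field_simp
  open_source := by
    have : Continuous fun p : S2 => p.1 0 := by fun_prop
    exact isOpen_ne.preimage this
  open_target := isOpen_univ
  continuousOn_toFun := by
    have h : ∀ p : S2, (⟨p.1 1 / (1 + p.1 0), p.1 2 / (1 + p.1 0)⟩ : ℂ)
        = ((p.1 1 / (1 + p.1 0) : ℝ) : ℂ) + ((p.1 2 / (1 + p.1 0) : ℝ) : ℂ) * Complex.I :=
      fun p => by apply Complex.ext <;> simp [-Complex.ofReal_div]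
    simp only [h]
    have h0 : ∀ p ∈ {p : S2 | p.1 0 ≠ -1}, 1 + p.1 0 ≠ 0 := fun p hp => S2.one_add_ne hp
    refine ContinuousOn.add ?_ (ContinuousOn.mul ?_ continuousOn_const) <;>
    refine Complex.continuous_ofReal.comp_continuousOn (ContinuousOn.div ?_ ?_ h0) <;> fun_prop
  continuousOn_invFun := by
    refine Continuous.continuousOn (Continuous.subtype_mk ?_ _)
    have h : ∀ z : ℂ, 1 + (z.re ^ 2 + z.im ^ 2) ≠ 0 := fun z => by positivity
    refine (PiLp.continuous_toLp 2 _).comp (continuous_pi fun i => ?_)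
    fin_cases i <;> simp <;> fun_prop (disch := exact h _)

/-- The rotation `(a, b, c) ↦ (-a, b, -c)`. -/
def rotation : S2 ≃ₜ S2 where
  toFun p := S2.mk (-p.1 0) (p.1 1) (-p.1 2) (by simpa using p.sum_sq)
  invFun p := S2.mk (-p.1 0) (p.1 1) (-p.1 2) (by simpa using p.sum_sq)
  left_inv p := S2.ext (by simp [S2.mk]) (by simp [S2.mk]) (by simp [S2.mk])
  right_inv p := S2.ext (by simp [S2.mk]) (by simp [S2.mk]) (by simp [S2.mk])
  continuous_toFun := by
    refine Continuous.subtype_mk ((PiLp.continuous_toLp 2 _).comp (continuous_pi fun i => ?_)) _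
    fin_cases i <;> simp <;> fun_prop
  continuous_invFun := by
    refine Continuous.subtype_mk ((PiLp.continuous_toLp 2 _).comp (continuous_pi fun i => ?_)) _
    fin_cases i <;> simp <;> fun_prop

/-- The complex conjugate `(b - ic) / (1 - a)` of stereographic projection from the other pole; the
conjugation makes the transition to `stereo` holomorphic. -/
def stereo' : OpenPartialHomeomorph S2 ℂ := rotation.toOpenPartialHomeomorph.trans stereo

lemma mem_stereo_source {p : S2} : p ∈ stereo.source ↔ p.1 0 ≠ -1 := Iff.rfl

lemma mem_stereo'_source {p : S2} : p ∈ stereo'.source ↔ rotation p ∈ stereo.source := by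
  simp [stereo']

lemma rotation_mem_stereo_source {p : S2} : rotation p ∈ stereo.source ↔ p.1 0 ≠ 1 := by
  rw [mem_stereo_source]
  simp [rotation, S2.mk, neg_eq_iff_eq_neg]

/-- The Riemann sphere: the charts are `z` and `1 / z`. -/
@[reducible] def riemannSphere : ChartedSpace ℂ S2 where
  atlas := {stereo, stereo'}
  chartAt p := open Classical in if p.1 0 = -1 then stereo' else stereo
  mem_chart_source p := by
    split_ifs with h
    · rw [mem_stereo'_source, rotation_mem_stereo_source, h]
      norm_num
    · exact h
  chart_mem_atlas p := by
    split_ifs <;> simp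

lemma stereo_rotation (z : ℂ) (hz : z ≠ 0) : stereo (rotation (stereo.symm z)) = z⁻¹ := by
  have h1 : 1 + (z.re ^ 2 + z.im ^ 2) ≠ 0 := by positivity
  have h2 : z.re ^ 2 + z.im ^ 2 ≠ 0 := by
    intro h
    exact hz (Complex.ext (by simp; nlinarith [sq_nonneg z.re, sq_nonneg z.im])
      (by simp; nlinarith [sq_nonneg z.re, sq_nonneg z.im]))
  have h3 : 1 + -((1 - (z.re ^ 2 + z.im ^ 2)) / (1 + (z.re ^ 2 + z.im ^ 2)))
      = 2 * (z.re ^ 2 + z.im ^ 2) / (1 + (z.re ^ 2 + z.im ^ 2)) := by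
    field_simp
    ring
  show (⟨2 * z.re / (1 + (z.re ^ 2 + z.im ^ 2)) /
      (1 + -((1 - (z.re ^ 2 + z.im ^ 2)) / (1 + (z.re ^ 2 + z.im ^ 2)))),
    -(2 * z.im / (1 + (z.re ^ 2 + z.im ^ 2))) /
      (1 + -((1 - (z.re ^ 2 + z.im ^ 2)) / (1 + (z.re ^ 2 + z.im ^ 2))))⟩ : ℂ) = z⁻¹
  rw [h3]
  apply Complex.ext
  · simp only [Complex.inv_re, Complex.normSq_apply, ← pow_two]
    field_simp
  · simp only [Complex.inv_im, Complex.normSq_apply, ← pow_two]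
    field_simp

lemma ne_zero_of_rotation_mem {z : ℂ} (h : rotation (stereo.symm z) ∈ stereo.source) : z ≠ 0 := by
  rintro rfl
  rw [rotation_mem_stereo_source] at h
  apply h
  show (1 - ((0 : ℂ).re ^ 2 + (0 : ℂ).im ^ 2)) / (1 + ((0 : ℂ).re ^ 2 + (0 : ℂ).im ^ 2)) = 1
  simp

attribute [local instance] riemannSphere

lemma isManifold_riemannSphere : IsManifold 𝓘(ℂ, ℂ) ω S2 := by
  refine isManifold_of_contDiffOn _ _ _ ?_
  have inv : ∀ f : ℂ → ℂ, ∀ s : Set ℂ, (∀ z ∈ s, z ≠ 0 ∧ f z = z⁻¹) → ContDiffOn ℂ ω f s :=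
    fun f s h => ContDiffOn.congr (fun z hz => (contDiffAt_inv ℂ (h z hz).1).contDiffWithinAt)
      fun z hz => (h z hz).2
  have refl : ∀ e : OpenPartialHomeomorph S2 ℂ, ContDiffOn ℂ ω (𝓘(ℂ, ℂ) ∘ (e.symm.trans e)
      ∘ 𝓘(ℂ, ℂ).symm) (𝓘(ℂ, ℂ).symm ⁻¹' (e.symm.trans e).source ∩ Set.range 𝓘(ℂ, ℂ)) :=
    fun e => contDiffOn_id.congr fun z hz => e.right_inv hz.1.1
  rintro _ _ (rfl | rfl) (rfl | rfl)
  · exact refl _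
  · refine inv _ _ fun z hz => ?_
    have h : rotation (stereo.symm z) ∈ stereo.source := mem_stereo'_source.1 hz.1.2
    have hz0 := ne_zero_of_rotation_mem h
    exact ⟨hz0, stereo_rotation z hz0⟩
  · refine inv _ _ fun z hz => ?_
    have h : rotation (stereo.symm z) ∈ stereo.source := hz.1.2
    have hz0 := ne_zero_of_rotation_mem h
    exact ⟨hz0, stereo_rotation z hz0⟩
  · exact refl _

end Sphere

/-- Every nonzero vector of a finite-dimensional space is the image of the first basis vector under
a linear isomorphism from `ℂ × ℂ^(d-1)`. -/
lemma exists_equiv_prod {E : Type*} [NormedAddCommGroup E] [NormedSpace ℂ E]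
    [FiniteDimensional ℂ E] {v : E} (hv : v ≠ 0) :
    ∃ e : (ℂ × (Fin (Module.finrank ℂ E - 1) → ℂ)) ≃L[ℂ] E, ∀ z : ℂ, e (z, 0) = z • v := by
  have : Nontrivial E := ⟨v, 0, hv⟩
  have hpos : 0 < Module.finrank ℂ E := Module.finrank_pos
  let e₀ : (ℂ × (Fin (Module.finrank ℂ E - 1) → ℂ)) ≃L[ℂ] E :=
    ContinuousLinearEquiv.ofFinrankEq (by simp; omega)
  have h0 : e₀ (1, 0) ≠ 0 := by simp
  obtain ⟨A, hA⟩ := SeparatingDual.exists_continuousLinearEquiv_apply_eq (R := ℂ) h0 hv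
  refine ⟨e₀.trans A, fun z => ?_⟩
  have : ((z, 0) : ℂ × (Fin (Module.finrank ℂ E - 1) → ℂ)) = z • (1, 0) := by simp
  rw [this, map_smul, ContinuousLinearEquiv.trans_apply, hA]

variable {V : Type*} [NormedAddCommGroup V] [NormedSpace ℂ V]

namespace QuaternionicPair

variable (q : QuaternionicPair V)

/-- For a quaternionic structure extending the standard complex structure, the holomorphic
coordinate restricts to `i` times the stereographic coordinate on the twistor sphere. -/
lemma coord_comb (hq : q.I = stdJ V) {a b c : ℝ} (h : a ^ 2 + b ^ 2 + c ^ 2 = 1) (ha : 1 + a ≠ 0) :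
    IsUnit (q.comb a b c + stdJ V) ∧
      coord (q.comb a b c) = (⟨b / (1 + a), c / (1 + a)⟩ : ℂ) • Complex.I • antiPart q.J := by
  have hI : stdJ V = q.comb 1 0 0 := by rw [← hq]; simp [comb]
  have hu : IsUnit (q.comb a b c + stdJ V) := by
    have hpos : 0 < 2 * (1 + a) := by
      have h1 : 0 < (1 + a) ^ 2 := by positivity
      nlinarith [sq_nonneg b, sq_nonneg c]
    obtain ⟨g, -, hg⟩ := exists_GLPlus (M := q.comb a b c + stdJ V) hpos (by
      rw [hI, comb_add_comb, comb_mul_self]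
      congr 2
      linear_combination h)
    exact ⟨g, hg⟩
  refine ⟨hu, coord_eq hu ?_⟩
  have hX : ((⟨b / (1 + a), c / (1 + a)⟩ : ℂ) • Complex.I • antiPart q.J).toReal
      = q.comb 0 (-(c / (1 + a))) (b / (1 + a)) := by
    have hJ : ∀ x, antiPart q.J x = q.J x := fun x => by
      have h1 : q.J * stdJ V = -(stdJ V * q.J) := by rw [← hq, q.anticomm, neg_neg]
      exact congrArg (fun S : REnd V => S x) (toReal_antiPart h1)
    ext x
    show (⟨b / (1 + a), c / (1 + a)⟩ : ℂ) • Complex.I • antiPart q.J x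
      = (0 : ℝ) • q.I x + (-(c / (1 + a))) • q.J x + (b / (1 + a)) • q.I (q.J x)
    rw [hJ, hq]
    show _ = (0 : ℝ) • (Complex.I • x) + (-(c / (1 + a))) • q.J x
      + (b / (1 + a)) • (Complex.I • q.J x)
    rw [zero_smul, zero_add, smul_smul, ← Complex.coe_smul, ← Complex.coe_smul, smul_smul,
      ← add_smul]
    congr 1
    apply Complex.ext <;> simp [-Complex.ofReal_div]
  rw [hX, mul_add, mul_one, add_mul, one_mul, hI, comb_mul_comb, comb_mul_comb]
  have e1 : a * 0 + b * -(c / (1 + a)) + c * (b / (1 + a)) = 0 := by ring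
  have e2 : a + (b * (b / (1 + a)) - c * -(c / (1 + a))) = 1 := by
    field_simp
    linear_combination h
  have e3 : b + (c * 0 - a * (b / (1 + a))) = b / (1 + a) := by
    field_simp
    ring
  have e4 : c + (a * -(c / (1 + a)) - b * 0) = c / (1 + a) := by
    field_simp
    ring
  rw [e1, zero_smul, neg_zero, zero_add, comb_add_comb, e2, e3, e4]
  simp only [comb]
  module

/-- Conjugation of a quaternionic pair. -/
def conjugate (h : GLPlus V) : QuaternionicPair V where
  I := ((h : (REnd V)ˣ) : REnd V) * q.I * (((h : (REnd V)ˣ)⁻¹ : (REnd V)ˣ) : REnd V)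
  J := ((h : (REnd V)ˣ) : REnd V) * q.J * (((h : (REnd V)ˣ)⁻¹ : (REnd V)ˣ) : REnd V)
  I_mem := Compl.conj_mem q.I_mem h.2
  J_sq := by
    calc _ = ((h : (REnd V)ˣ) : REnd V) * (q.J * q.J)
            * (((h : (REnd V)ˣ)⁻¹ : (REnd V)ˣ) : REnd V) := by
          simp only [mul_assoc, Units.inv_mul_cancel_left]
      _ = -1 := by rw [q.J_sq]; simp
  anticomm := by
    calc _ = ((h : (REnd V)ˣ) : REnd V) * (q.I * q.J)
            * (((h : (REnd V)ˣ)⁻¹ : (REnd V)ˣ) : REnd V) := by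
          simp only [mul_assoc, Units.inv_mul_cancel_left]
      _ = _ := by
          rw [q.anticomm]
          simp only [mul_neg, neg_mul, mul_assoc, Units.inv_mul_cancel_left]

lemma conjugate_comb (h : GLPlus V) (a b c : ℝ) : (q.conjugate h).comb a b c
    = ((h : (REnd V)ˣ) : REnd V) * q.comb a b c * (((h : (REnd V)ˣ)⁻¹ : (REnd V)ˣ) : REnd V) := by
  simp only [comb, conjugate, mul_add, add_mul, mul_smul_comm, smul_mul_assoc]
  simp only [mul_assoc, Units.inv_mul_cancel_left]

/-- The pair `(-I, J)`: the same twistor sphere, based at the antipode of `I`. -/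
def antipode : QuaternionicPair V where
  I := -q.I
  J := q.J
  I_mem := by
    have h := q.comb_mem (a := -1) (b := 0) (c := 0) (by norm_num)
    simpa [comb] using h
  J_sq := q.J_sq
  anticomm := by rw [neg_mul, q.anticomm, mul_neg]

lemma antipode_sphereMap (p : S2) : q.antipode.sphereMap (rotation p) = q.sphereMap p := by
  apply Subtype.ext
  show q.antipode.comb (-p.1 0) (p.1 1) (-p.1 2) = q.comb (p.1 0) (p.1 1) (p.1 2)
  simp only [comb, antipode, neg_mul]
  module

lemma injective_sphereMap [Nontrivial V] : Function.Injective q.sphereMap := by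
  intro p p' h
  have h1 : q.comb (p.1 0) (p.1 1) (p.1 2) = q.comb (p'.1 0) (p'.1 1) (p'.1 2) :=
    congrArg Subtype.val h
  have h2 : q.comb (p.1 0 - p'.1 0) (p.1 1 - p'.1 1) (p.1 2 - p'.1 2) = 0 := by
    have : q.comb (p.1 0 - p'.1 0) (p.1 1 - p'.1 1) (p.1 2 - p'.1 2)
        = q.comb (p.1 0) (p.1 1) (p.1 2) - q.comb (p'.1 0) (p'.1 1) (p'.1 2) := by
      simp only [comb]
      module
    rw [this, h1, sub_self]
  have h3 := q.comb_mul_self (p.1 0 - p'.1 0) (p.1 1 - p'.1 1) (p.1 2 - p'.1 2)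
  rw [h2, mul_zero, eq_comm, neg_eq_zero] at h3
  have h4 := (smul_eq_zero.1 h3).resolve_right one_ne_zero
  have s0 := sq_nonneg (p.1 0 - p'.1 0)
  have s1 := sq_nonneg (p.1 1 - p'.1 1)
  have s2 := sq_nonneg (p.1 2 - p'.1 2)
  refine S2.ext (sub_eq_zero.1 ?_) (sub_eq_zero.1 ?_) (sub_eq_zero.1 ?_) <;>
    refine pow_eq_zero_iff two_ne_zero |>.1 ?_ <;> linarith

lemma continuous_sphereMap : Continuous q.sphereMap := by
  refine Continuous.subtype_mk ?_ _
  simp only [comb]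
  fun_prop

variable [FiniteDimensional ℂ V]

/-- In a suitable chart of the period domain, the twistor sphere is a complex line. -/
lemma exists_chart [Nontrivial V] : ∃ (g : GLPlus V) (v : Anti V), v ≠ 0 ∧
    ∀ p ∈ stereo.source, q.sphereMap p ∈ (chart g).source ∧
      chart g (q.sphereMap p) = stereo p • v := by
  obtain ⟨g, hg, hI⟩ := q.I_mem
  let h : GLPlus V := (⟨g, hg⟩ : GLPlus V)⁻¹
  have hq : (q.conjugate h).I = stdJ V := by
    show ((g⁻¹ : (REnd V)ˣ) : REnd V) * q.I * ((g⁻¹⁻¹ : (REnd V)ˣ) : REnd V) = _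
    rw [hI]
    simp [mul_assoc]
  have hJ0 : antiPart (q.conjugate h).J ≠ 0 := by
    intro h0
    have h1 : (q.conjugate h).J * stdJ V = -(stdJ V * (q.conjugate h).J) := by
      rw [← hq, (q.conjugate h).anticomm, neg_neg]
    have h2 := toReal_antiPart h1
    have h3 : (q.conjugate h).J = 0 := by
      rw [← h2, h0]
      rfl
    have h4 := (q.conjugate h).J_sq
    rw [h3, mul_zero] at h4
    exact one_ne_zero (neg_eq_zero.1 h4.symm)
  refine ⟨⟨g, hg⟩, Complex.I • antiPart (q.conjugate h).J, smul_ne_zero Complex.I_ne_zero hJ0,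
    fun p hp => ?_⟩
  obtain ⟨h1, h2⟩ := (q.conjugate h).coord_comb hq p.sum_sq (S2.one_add_ne hp)
  rw [conjugate_comb] at h1 h2
  exact ⟨⟨trivial, h1⟩, h2⟩

end QuaternionicPair

variable [FiniteDimensional ℂ V]

instance : FiniteDimensional ℂ (Anti V) := by
  obtain ⟨c, hc⟩ := exists_conj V
  let p : Anti V →L[ℂ] (V →L[ℂ] V) :=
    (ContinuousLinearMap.compSL V V V (starRingEnd ℂ) (starRingEnd ℂ)).flip c
  refine FiniteDimensional.of_injective p.toLinearMap fun X Y h => ?_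
  ext x
  have h1 : X (c (c x)) = Y (c (c x)) := congrArg (fun S : V →L[ℂ] V => S (c x)) h
  rwa [hc] at h1

attribute [local instance] riemannSphere

/-- A map of the Riemann sphere that is linear in charts is an immersion. -/
lemma isImmersionAt_of_eq_smul {f : S2 → Compl V} {φ : OpenPartialHomeomorph S2 ℂ}
    (hφ : φ ∈ ({stereo, stereo'} : Set (OpenPartialHomeomorph S2 ℂ))) {g : GLPlus V} {v : Anti V}
    (hv : v ≠ 0) (h : ∀ p ∈ φ.source, f p ∈ (chart g).source ∧ chart g (f p) = φ p • v)
    {p : S2} (hp : p ∈ φ.source) :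
    Manifold.IsImmersionAtOfComplement (Fin (Module.finrank ℂ (Anti V) - 1) → ℂ) 𝓘(ℂ, ℂ)
      𝓘(ℂ, Anti V) ω f p := by
  have := isManifold_riemannSphere
  obtain ⟨e, he⟩ := exists_equiv_prod hv
  refine Manifold.IsImmersionAtOfComplement.mk_of_charts e φ (chart g) hp (h p hp).1
    (IsManifold.subset_maximalAtlas hφ) (IsManifold.subset_maximalAtlas ⟨g, rfl⟩)
    (fun p hp => (h p hp).1) fun z hz => ?_
  have hz' : z ∈ φ.target := by simpa using hz
  show chart g (f (φ.symm z)) = e (z, 0)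
  rw [(h _ (φ.map_target hz')).2, φ.right_inv hz', he]

lemma QuaternionicPair.isSmoothEmbedding_sphereMap [Nontrivial V] (q : QuaternionicPair V) :
    Manifold.IsSmoothEmbedding 𝓘(ℂ, ℂ) 𝓘(ℂ, Anti V) ω q.sphereMap := by
  refine ⟨Manifold.IsImmersionOfComplement.isImmersion
    (F := Fin (Module.finrank ℂ (Anti V) - 1) → ℂ) fun p => ?_,
    (q.continuous_sphereMap.isClosedEmbedding q.injective_sphereMap).isEmbedding⟩
  by_cases hp : p ∈ stereo.source
  · obtain ⟨g, v, hv, h⟩ := q.exists_chart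
    exact isImmersionAt_of_eq_smul (Set.mem_insert _ _) hv h hp
  · obtain ⟨g, v, hv, h⟩ := q.antipode.exists_chart
    refine isImmersionAt_of_eq_smul (φ := stereo') (g := g) (v := v) (by simp) hv
      (fun p hp => ?_) ?_
    · have h1 := h _ (mem_stereo'_source.1 hp)
      rwa [q.antipode_sphereMap] at h1
    · rw [mem_stereo_source, not_not] at hp
      rw [mem_stereo'_source, rotation_mem_stereo_source, hp]
      norm_num

end

/-! ### Connectedness of the period domain -/

section

/-- A matrix can be deformed to the identity through matrices of positive determinant. -/
def DeformsToOne {ι : Type*} [Fintype ι] [DecidableEq ι] (A : Matrix ι ι ℝ) : Prop :=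
  ∃ γ : ℝ → Matrix ι ι ℝ, Continuous γ ∧ γ 0 = 1 ∧ γ 1 = A ∧ ∀ t ∈ Set.Icc (0 : ℝ) 1, 0 < (γ t).det

section Matrix
variable {ι : Type*} [Fintype ι] [DecidableEq ι]

lemma DeformsToOne.mul {A B : Matrix ι ι ℝ} (hA : DeformsToOne A) (hB : DeformsToOne B) :
    DeformsToOne (A * B) := by
  obtain ⟨γ, h1, h2, h3, h4⟩ := hA
  obtain ⟨δ, k1, k2, k3, k4⟩ := hB
  refine ⟨fun t => γ t * δ t, h1.mul k1, by simp [h2, k2], by simp [h3, k3], fun t ht => ?_⟩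
  rw [Matrix.det_mul]
  exact mul_pos (h4 t ht) (k4 t ht)

lemma deformsToOne_transvection {i j : ι} (hij : i ≠ j) (c : ℝ) :
    DeformsToOne (Matrix.transvection i j c) := by
  refine ⟨fun t => Matrix.transvection i j (t * c), ?_, by simp, by simp, fun t _ => ?_⟩
  · refine continuous_matrix fun k l => ?_
    simp only [Matrix.transvection, Matrix.add_apply, Matrix.single_apply]
    split_ifs <;> fun_prop
  · rw [Matrix.det_transvection_of_ne _ _ hij]
    exact one_pos

/-- The matrix `diag(c, c⁻¹)` in two coordinates is a product of six transvections. -/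
lemma diagonal_pair_eq_transvections {i j : ι} (hij : i ≠ j) {c : ℝ} (hc : c ≠ 0) :
    Matrix.transvection i j c * Matrix.transvection j i (-c⁻¹) * Matrix.transvection i j c *
      Matrix.transvection i j (-1) * Matrix.transvection j i 1 * Matrix.transvection i j (-1)
      = 1 + Matrix.single i i (c - 1) + Matrix.single j j (c⁻¹ - 1) := by
  simp only [Matrix.transvection, mul_add, add_mul, one_mul, mul_one,
    Matrix.single_mul_single_same, Matrix.single_mul_single_of_ne _ _ _ _ hij,
    Matrix.single_mul_single_of_ne _ _ _ _ hij.symm, add_zero]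
  ext k l
  simp only [Matrix.add_apply, Matrix.single_apply]
  split_ifs <;> simp_all <;> field_simp <;> ring

lemma deformsToOne_specialLinear [Nontrivial ι] (A : Matrix.SpecialLinearGroup ι ℝ) :
    DeformsToOne (A : Matrix ι ι ℝ) := by
  refine Matrix.SpecialLinearGroup.diagonal_transvection_induction'
    (fun A => DeformsToOne (A : Matrix ι ι ℝ)) A (fun i j hij c hc => ?_)
    (fun i j hij c => ?_) (fun A B hA hB => ?_)
  · have h : (Matrix.SpecialLinearGroup.diag2n hij c hc : Matrix ι ι ℝ)
        = 1 + Matrix.single i i (c - 1) + Matrix.single j j (c⁻¹ - 1) := by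
      ext k l
      simp only [Matrix.SpecialLinearGroup.diag2n_coe, Matrix.diagonal_apply, Matrix.add_apply,
        Matrix.single_apply, Matrix.one_apply]
      split_ifs <;> grind
    rw [h, ← diagonal_pair_eq_transvections hij hc]
    exact (((((deformsToOne_transvection hij c).mul (deformsToOne_transvection hij.symm _)).mul
      (deformsToOne_transvection hij c)).mul (deformsToOne_transvection hij _)).mul
      (deformsToOne_transvection hij.symm _)).mul (deformsToOne_transvection hij _)
  · exact deformsToOne_transvection hij c
  · simpa using hA.mul hB

/-- `GL⁺(ℝ)` is path connected: after scaling, the determinant is `1`, and the special linear group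
is generated by transvections and by diagonal matrices that are products of transvections. -/
lemma deformsToOne_of_det_pos [Nontrivial ι] {A : Matrix ι ι ℝ} (hA : 0 < A.det) :
    DeformsToOne A := by
  have hcard : (Fintype.card ι : ℝ) ≠ 0 := by
    exact_mod_cast Fintype.card_ne_zero
  set r : ℝ := A.det ^ (1 / (Fintype.card ι : ℝ)) with hr
  have hr0 : 0 < r := Real.rpow_pos_of_pos hA _
  have hrn : r ^ Fintype.card ι = A.det := by
    rw [hr, ← Real.rpow_natCast, ← Real.rpow_mul hA.le, one_div, inv_mul_cancel₀ hcard,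
      Real.rpow_one]
  have hB : (r⁻¹ • A).det = 1 := by
    rw [Matrix.det_smul, inv_pow, hrn, inv_mul_cancel₀ hA.ne']
  have h1 := deformsToOne_specialLinear ⟨r⁻¹ • A, hB⟩
  have h2 : DeformsToOne (r • (1 : Matrix ι ι ℝ)) := by
    refine ⟨fun t => (1 - t + t * r) • (1 : Matrix ι ι ℝ), by fun_prop, by simp, by simp,
      fun t ht => ?_⟩
    rw [Matrix.det_smul, Matrix.det_one, mul_one]
    refine pow_pos ?_ _
    obtain ⟨h0, h1⟩ := ht
    rcases h0.eq_or_lt with rfl | h0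
    · simp
    · have := mul_pos h0 hr0
      linarith
  have h3 := h2.mul h1
  have h4 : r • (1 : Matrix ι ι ℝ) * (r⁻¹ • A) = A := by
    rw [smul_mul_smul_comm, mul_inv_cancel₀ hr0.ne', one_smul, one_mul]
  simpa only [h4] using h3
end Matrix

variable {V : Type*} [NormedAddCommGroup V] [NormedSpace ℂ V] [FiniteDimensional ℂ V]

/-- The period domain is the orbit of the base point under the connected group `GL⁺(V_ℝ)`. -/
lemma preconnectedSpace_compl (hV : 1 ≤ Module.finrank ℂ V) :
    PreconnectedSpace (Compl V) := by
  have : CompleteSpace V := FiniteDimensional.complete ℂ V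
  have hfr : 1 < Module.finrank ℝ V := by
    rw [← Module.finrank_mul_finrank ℝ ℂ V, Complex.finrank_real_complex]
    omega
  have : Nontrivial (Fin (Module.finrank ℝ V)) := Fin.nontrivial_iff_two_le.2 hfr
  let b := Module.finBasis ℝ V
  refine ⟨isPreconnected_of_forall ⟨stdJ V, stdJ_mem V⟩ ?_⟩
  rintro ⟨I, g, hg, rfl⟩ -
  have hdet : 0 < (LinearMap.toMatrix b b ((g : REnd V) : V →ₗ[ℝ] V)).det := by
    rw [LinearMap.det_toMatrix]; exact hg
  obtain ⟨γ, h1, h2, h3, h4⟩ := deformsToOne_of_det_pos hdet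
  let L : Matrix _ _ ℝ →ₗ[ℝ] REnd V :=
    (LinearMap.toContinuousLinearMap (𝕜 := ℝ) (E := V) (F' := V)).toLinearMap ∘ₗ
      (Matrix.toLin b b).toLinearMap
  have hL : Continuous L := L.continuous_of_finiteDimensional
  have hLdet : ∀ A, (L A).det = A.det := fun A => LinearMap.det_toLin b A
  have hL1 : L 1 = 1 := by
    ext x
    simp [L]
  have hLg : L (γ 1) = g := by
    ext x
    simp [L, h3]
  let δ : Set.Icc (0 : ℝ) 1 → Compl V := fun t =>
    ⟨L (γ t) * stdJ V * Ring.inverse (L (γ t)), by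
      have hpos : 0 < (L (γ t)).det := by rw [hLdet]; exact h4 t t.2
      obtain ⟨u, hu⟩ := isUnit_of_det_pos hpos
      refine ⟨u, ?_, by rw [← hu, Ring.inverse_unit]⟩
      show 0 < (u : REnd V).det
      rwa [hu]⟩
  have hδ : Continuous δ := by
    refine Continuous.subtype_mk ?_ _
    have hc : Continuous fun t : Set.Icc (0 : ℝ) 1 => L (γ t) :=
      hL.comp (h1.comp continuous_subtype_val)
    refine (hc.mul continuous_const).mul ?_
    rw [continuous_iff_continuousAt]
    intro t
    refine ContinuousAt.comp (g := Ring.inverse) ?_ hc.continuousAt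
    have hpos : 0 < (L (γ t)).det := by rw [hLdet]; exact h4 t t.2
    obtain ⟨u, hu⟩ := isUnit_of_det_pos hpos
    rw [← hu]
    exact NormedRing.inverse_continuousAt u
  refine ⟨Set.range δ, Set.subset_univ _, ⟨⟨0, by simp⟩, ?_⟩, ⟨⟨1, by simp⟩, ?_⟩,
    isPreconnected_range hδ⟩
  · apply Subtype.ext
    simp [δ, h2, hL1]
  · apply Subtype.ext
    simp [δ, hLg]

end

/-! ### Square roots, and complex structures anticommuting with a given pair -/

section

section Ring

variable {R : Type*} [Ring R]

lemma isUnit_of_sq_eq_neg_one {K : R} (hK : K * K = -1) : IsUnit K :=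
  ⟨⟨K, -K, by rw [mul_neg, hK, neg_neg], by rw [neg_mul, hK, neg_neg]⟩, rfl⟩

/-- Commuting square roots of `-1` whose sum is invertible are equal. -/
lemma eq_of_commute_of_isUnit_add {A B : R} (hA : A * A = -1) (hB : B * B = -1)
    (h : A * B = B * A) (hu : IsUnit (A + B)) : A = B := by
  obtain ⟨u, hu⟩ := hu
  have h1 : (u : R) * (A - B) = 0 := by
    rw [hu, mul_sub, add_mul, add_mul, hA, hB, h]
    abel
  rw [Units.mul_right_eq_zero] at h1
  exact sub_eq_zero.1 h1

lemma mul_sq_eq_neg_one {A₀ B₀ : R} (hA : A₀ * A₀ = -1) (hB : B₀ * B₀ = -1)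
    (h : A₀ * B₀ = -(B₀ * A₀)) :
    A₀ * B₀ * (A₀ * B₀) = -1 := by
  calc A₀ * B₀ * (A₀ * B₀) = -(B₀ * (A₀ * A₀) * B₀) := by
        nth_rewrite 1 [h]; simp only [neg_mul, mul_assoc]
    _ = -1 := by rw [hA]; simp [hB]

end Ring

section BanachAlgebra

variable {R : Type*} [NormedRing R] [NormedAlgebra ℝ R] [CompleteSpace R]

variable (R) in
/-- The derivative of squaring at `1` is multiplication by `2`, so squaring is a local homeomorphism
there. -/
lemma exists_localSquare : ∃ e : OpenPartialHomeomorph R R,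
    (1 : R) ∈ e.source ∧ ∀ x, e x = x * x := by
  have h : HasStrictFDerivAt (fun x : R => x * x)
      ((ContinuousLinearEquiv.smulLeft (Units.mk0 (2 : ℝ) two_ne_zero) : R ≃L[ℝ] R) :
        R →L[ℝ] R) 1 := by
    have h1 := (hasStrictFDerivAt_id (𝕜 := ℝ) (1 : R)).mul' (hasStrictFDerivAt_id (𝕜 := ℝ) (1 : R))
    have h2 : ((ContinuousLinearEquiv.smulLeft (Units.mk0 (2 : ℝ) two_ne_zero) : R ≃L[ℝ] R) :
        R →L[ℝ] R) = (id 1 : R) • ContinuousLinearMap.id ℝ R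
          + MulOpposite.op (id 1 : R) • ContinuousLinearMap.id ℝ R := by
      ext x
      simp [Units.smul_def, two_smul]
    rw [h2]
    exact h1
  exact ⟨h.toOpenPartialHomeomorph _, h.mem_toOpenPartialHomeomorph_source, fun x => rfl⟩

/-- The square root near `1`: the inverse of a local homeomorphism given by squaring. Its values are
meaningful only near `1`. -/
def localSqrt (x : R) : R := (exists_localSquare R).choose.symm x

lemma localSqrt_one : localSqrt (1 : R) = 1 := by
  obtain ⟨h1, h2⟩ := (exists_localSquare R).choose_spec
  have h3 := (exists_localSquare R).choose.left_inv h1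
  rwa [h2, one_mul] at h3

lemma eventually_localSqrt : ∀ᶠ x in 𝓝 (1 : R),
    ContinuousAt localSqrt x ∧ localSqrt x * localSqrt x = x := by
  obtain ⟨h1, h2⟩ := (exists_localSquare R).choose_spec
  have h3 := (exists_localSquare R).choose.map_source h1
  rw [h2, one_mul] at h3
  filter_upwards [(exists_localSquare R).choose.open_target.mem_nhds h3] with x hx
  refine ⟨(exists_localSquare R).choose.continuousAt_symm hx, ?_⟩
  rw [← h2]
  exact (exists_localSquare R).choose.right_inv hx

lemma tendsto_localSqrt : Tendsto (localSqrt : R → R) (𝓝 1) (𝓝 1) := by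
  have h := (eventually_localSqrt (R := R)).self_of_nhds.1
  rwa [ContinuousAt, localSqrt_one] at h

/-- By uniqueness of the square root near `1`, it commutes with what commutes with its argument. -/
lemma eventually_localSqrt_commute {g₀ : R} (hg : IsUnit g₀) : ∀ᶠ p : R × R in 𝓝 (g₀, 1),
    p.1 * p.2 = p.2 * p.1 → p.1 * localSqrt p.2 = localSqrt p.2 * p.1 := by
  obtain ⟨h1, h2⟩ := (exists_localSquare R).choose_spec
  have t1 : Tendsto (fun p : R × R => p.1) (𝓝 (g₀, 1)) (𝓝 g₀) := continuous_fst.tendsto _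
  have t2 : Tendsto (fun p : R × R => p.2) (𝓝 (g₀, 1)) (𝓝 1) := continuous_snd.tendsto _
  have t3 := tendsto_localSqrt.comp t2
  have t4 : Tendsto (fun p : R × R => Ring.inverse p.1) (𝓝 (g₀, 1)) (𝓝 (Ring.inverse g₀)) := by
    obtain ⟨u, rfl⟩ := hg
    exact (NormedRing.inverse_continuousAt u).tendsto.comp t1
  have t5 := (t1.mul t3).mul t4
  rw [mul_one, Ring.mul_inverse_cancel _ hg] at t5
  have ho := (exists_localSquare R).choose.open_source.mem_nhds h1
  filter_upwards [t1 (Units.isOpen.mem_nhds hg), t2 eventually_localSqrt, t3 ho, t5 ho]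
    with p hp1 hp2 hp3 hp4 hc
  obtain ⟨⟨u, hu⟩, ⟨-, hsq⟩⟩ := And.intro hp1 hp2
  simp only [Function.comp, Set.mem_preimage] at hp3 hp4
  simp only [← hu, Ring.inverse_unit] at hc hp4 ⊢
  have h3 : (u : R) * localSqrt p.2 * ((u⁻¹ : Rˣ) : R) = localSqrt p.2 := by
    refine (exists_localSquare R).choose.injOn hp4 hp3 ?_
    rw [h2, h2, hsq]
    calc _ = (u : R) * (localSqrt p.2 * localSqrt p.2) * ((u⁻¹ : Rˣ) : R) := by
          simp only [mul_assoc, Units.inv_mul_cancel_left]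
      _ = p.2 := by rw [hsq, hc, Units.mul_inv_cancel_right]
  nth_rewrite 2 [← h3]
  rw [Units.inv_mul_cancel_right]

/-- The phase `X (-X²)^{-1/2}` in the polar decomposition of an element `X` whose square is close
to `-1`. -/
def phase (X : R) : R := Ring.inverse (localSqrt (-(X * X))) * X

variable {K : R} (hK : K * K = -1)
include hK

lemma phase_eq_self : phase K = K := by
  rw [phase, hK, neg_neg, localSqrt_one, Ring.inverse_one, one_mul]

omit [NormedAlgebra ℝ R] [CompleteSpace R] in
lemma tendsto_neg_sq : Tendsto (fun X : R => -(X * X)) (𝓝 K) (𝓝 1) := by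
  have h : ContinuousAt (fun X : R => -(X * X)) K := by fun_prop
  rwa [ContinuousAt, hK, neg_neg] at h

lemma eventually_isUnit_localSqrt : ∀ᶠ X in 𝓝 K, IsUnit (localSqrt (-(X * X))) :=
  (tendsto_localSqrt.comp (tendsto_neg_sq hK)) (Units.isOpen.mem_nhds isUnit_one)

lemma eventually_continuousAt_phase : ∀ᶠ X in 𝓝 K, ContinuousAt phase X := by
  filter_upwards [eventually_isUnit_localSqrt hK, tendsto_neg_sq hK eventually_localSqrt]
    with X hX hX'
  refine ContinuousAt.mul ?_ continuousAt_id
  obtain ⟨u, hu⟩ := hX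
  have h1 : ContinuousAt (fun X : R => localSqrt (-(X * X))) X :=
    ContinuousAt.comp (g := localSqrt) hX'.1 (by fun_prop)
  refine ContinuousAt.comp (g := Ring.inverse) ?_ h1
  rw [← hu]
  exact NormedRing.inverse_continuousAt u

lemma eventually_phase_commute {g₀ : R} (hg : IsUnit g₀) : ∀ᶠ p : R × R in 𝓝 (g₀, K),
    (p.1 * p.2 = p.2 * p.1 → p.1 * phase p.2 = phase p.2 * p.1) ∧
    (p.1 * p.2 = -(p.2 * p.1) → p.1 * phase p.2 = -(phase p.2 * p.1)) := by
  have t1 : Tendsto (fun p : R × R => p.1) (𝓝 (g₀, K)) (𝓝 g₀) := continuous_fst.tendsto _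
  have t2 : Tendsto (fun p : R × R => p.2) (𝓝 (g₀, K)) (𝓝 K) := continuous_snd.tendsto _
  have t3 := t1.prodMk_nhds ((tendsto_neg_sq hK).comp t2)
  filter_upwards [t3 (eventually_localSqrt_commute hg), t2 (eventually_isUnit_localSqrt hK)]
    with p hp hu
  obtain ⟨u, hu⟩ := hu
  have key : p.1 * (p.2 * p.2) = p.2 * p.2 * p.1 →
      p.1 * ((u⁻¹ : Rˣ) : R) = ((u⁻¹ : Rˣ) : R) * p.1 := by
    intro h
    have h1 := hp (by simp only [Function.comp, mul_neg, neg_mul, h])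
    simp only [Function.comp] at h1
    rw [← hu] at h1
    rw [Units.mul_inv_eq_iff_eq_mul, mul_assoc, h1, Units.inv_mul_cancel_left]
  simp only [phase, ← hu, Ring.inverse_unit]
  constructor
  · intro h
    have h1 := key (by rw [← mul_assoc, h, mul_assoc, h, mul_assoc])
    rw [← mul_assoc, h1, mul_assoc, h, mul_assoc]
  · intro h
    have h1 := key (by rw [← mul_assoc, h, neg_mul, mul_assoc, h, mul_neg, neg_neg, mul_assoc])
    rw [← mul_assoc, h1, mul_assoc, h, mul_neg, mul_assoc]

lemma eventually_phase_sq : ∀ᶠ X in 𝓝 K, phase X * phase X = -1 := by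
  have t : Tendsto (fun X : R => (X, X)) (𝓝 K) (𝓝 (K, K)) := tendsto_id.prodMk_nhds tendsto_id
  filter_upwards [t (eventually_phase_commute hK (isUnit_of_sq_eq_neg_one hK)),
    eventually_isUnit_localSqrt hK, tendsto_neg_sq hK eventually_localSqrt] with X h1 h2 h3
  obtain ⟨u, hu⟩ := h2
  have h4 : X * phase X = phase X * X := h1.1 rfl
  have h5 : (u : R) * u = -(X * X) := by rw [hu]; exact h3.2
  have h6 : (u : R) * phase X = X := by
    rw [phase, ← hu, Ring.inverse_unit, Units.mul_inv_cancel_left]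
  have h7 : (u : R) * u * (phase X * phase X) = X * X := by
    rw [mul_assoc, ← mul_assoc _ (phase X), h6, h4, ← mul_assoc, h6]
  have h8 : (u : R) * (u * (phase X * phase X + 1)) = 0 := by
    rw [← mul_assoc, mul_add, h7, mul_one, h5, add_neg_cancel]
  rw [Units.mul_right_eq_zero, Units.mul_right_eq_zero] at h8
  exact eq_neg_of_add_eq_zero_left h8

omit hK

/-- The phase of half the commutator. If `A` and `B` are complex structures that nearly
anticommute, this is the complex structure near `AB` anticommuting with both. -/
def third (A B : R) : R := phase ((1 / 2 : ℝ) • (A * B - B * A))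

variable {A₀ B₀ : R}

omit [CompleteSpace R] in
lemma half_commutator (h : A₀ * B₀ = -(B₀ * A₀)) :
    (1 / 2 : ℝ) • (A₀ * B₀ - B₀ * A₀) = A₀ * B₀ := by
  rw [show B₀ * A₀ = -(A₀ * B₀) by rw [h, neg_neg]]
  module

variable (hA : A₀ * A₀ = -1) (hB : B₀ * B₀ = -1) (hAB : A₀ * B₀ = -(B₀ * A₀))
include hA hB hAB

lemma third_eq_mul : third A₀ B₀ = A₀ * B₀ := by
  rw [third, half_commutator hAB, phase_eq_self (mul_sq_eq_neg_one hA hB hAB)]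

omit [CompleteSpace R] hA hB in
lemma tendsto_half_commutator :
    Tendsto (fun p : R × R => (1 / 2 : ℝ) • (p.1 * p.2 - p.2 * p.1)) (𝓝 (A₀, B₀))
      (𝓝 (A₀ * B₀)) := by
  have h : ContinuousAt (fun p : R × R => (1 / 2 : ℝ) • (p.1 * p.2 - p.2 * p.1)) (A₀, B₀) := by
    fun_prop
  rwa [ContinuousAt, half_commutator hAB] at h

lemma eventually_continuousAt_third : ∀ᶠ p in 𝓝 (A₀, B₀),
    ContinuousAt (fun p : R × R => third p.1 p.2) p := by
  filter_upwards [tendsto_half_commutator hAB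
    (eventually_continuousAt_phase (mul_sq_eq_neg_one hA hB hAB))] with p hp
  exact ContinuousAt.comp (f := fun p : R × R => (1 / 2 : ℝ) • (p.1 * p.2 - p.2 * p.1))
    (g := phase) hp (by fun_prop)

lemma tendsto_third : Tendsto (fun p : R × R => third p.1 p.2) (𝓝 (A₀, B₀)) (𝓝 (A₀ * B₀)) := by
  have h := (eventually_continuousAt_third hA hB hAB).self_of_nhds
  rwa [ContinuousAt, third_eq_mul hA hB hAB] at h

/-- `third A B` is a complex structure anticommuting with `A` and `B`: its argument, the commutator,
anticommutes with both of them. -/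
lemma eventually_third : ∀ᶠ p in 𝓝 (A₀, B₀), p.1 * p.1 = -1 → p.2 * p.2 = -1 →
    third p.1 p.2 * third p.1 p.2 = -1 ∧ p.1 * third p.1 p.2 = -(third p.1 p.2 * p.1) ∧
      p.2 * third p.1 p.2 = -(third p.1 p.2 * p.2) := by
  have t := tendsto_half_commutator hAB
  have hK := mul_sq_eq_neg_one hA hB hAB
  have t1 : Tendsto (fun p : R × R => p.1) (𝓝 (A₀, B₀)) (𝓝 A₀) := continuous_fst.tendsto _
  have t2 : Tendsto (fun p : R × R => p.2) (𝓝 (A₀, B₀)) (𝓝 B₀) := continuous_snd.tendsto _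
  filter_upwards [t (eventually_phase_sq hK),
    (t1.prodMk_nhds t) (eventually_phase_commute hK (isUnit_of_sq_eq_neg_one hA)),
    (t2.prodMk_nhds t) (eventually_phase_commute hK (isUnit_of_sq_eq_neg_one hB))]
    with p h1 h2 h3 hp1 hp2
  refine ⟨h1, h2.2 ?_, h3.2 ?_⟩
  · rw [mul_smul_comm, smul_mul_assoc, ← smul_neg, mul_sub, sub_mul, ← mul_assoc, hp1,
      mul_assoc p.2, hp1, mul_assoc]
    congr 1
    simp only [neg_mul, mul_neg, one_mul, mul_one]
    abel
  · rw [mul_smul_comm, smul_mul_assoc, ← smul_neg, mul_sub, sub_mul, ← mul_assoc p.2 p.2, hp2,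
      mul_assoc p.1, hp2, mul_assoc]
    congr 1
    simp only [neg_mul, mul_neg, one_mul, mul_one]
    abel

/-- Uniqueness of the third complex structure: a complex structure anticommuting with `A` and `B`
commutes with their commutator, hence with `third A B`. -/
lemma eventually_eq_third : ∀ᶠ p : (R × R) × R in 𝓝 ((A₀, B₀), A₀ * B₀),
    p.1.1 * p.1.1 = -1 → p.1.2 * p.1.2 = -1 → p.2 * p.2 = -1 →
    p.1.1 * p.2 = -(p.2 * p.1.1) → p.1.2 * p.2 = -(p.2 * p.1.2) → p.2 = third p.1.1 p.1.2 := by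
  have hK := mul_sq_eq_neg_one hA hB hAB
  have t1 : Tendsto (fun p : (R × R) × R => p.1) (𝓝 ((A₀, B₀), A₀ * B₀)) (𝓝 (A₀, B₀)) :=
    continuous_fst.tendsto _
  have t2 : Tendsto (fun p : (R × R) × R => p.2) (𝓝 ((A₀, B₀), A₀ * B₀)) (𝓝 (A₀ * B₀)) :=
    continuous_snd.tendsto _
  have t3 := (tendsto_half_commutator hAB).comp t1
  have t4 := t2.add ((tendsto_third hA hB hAB).comp t1)
  have hu : IsUnit (A₀ * B₀ + A₀ * B₀) := by
    rw [← two_smul ℝ (A₀ * B₀)]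
    exact (isUnit_of_sq_eq_neg_one hK).smul (Units.mk0 (2 : ℝ) two_ne_zero)
  filter_upwards [t4 (Units.isOpen.mem_nhds hu), t1 (eventually_third hA hB hAB),
    (t2.prodMk_nhds t3) (eventually_phase_commute hK (isUnit_of_sq_eq_neg_one hK))]
    with p h1 h2 h3 hp1 hp2 hp3 hp4 hp5
  refine eq_of_commute_of_isUnit_add hp3 (h2 hp1 hp2).1 (h3.1 ?_) h1
  have e1 : p.2 * p.1.1 = -(p.1.1 * p.2) := by rw [hp4, neg_neg]
  have e2 : p.2 * p.1.2 = -(p.1.2 * p.2) := by rw [hp5, neg_neg]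
  have e3 : p.2 * (p.1.1 * p.1.2) = p.1.1 * p.1.2 * p.2 := by
    rw [← mul_assoc, e1, neg_mul, mul_assoc, e2, mul_neg, neg_neg, mul_assoc]
  have e4 : p.2 * (p.1.2 * p.1.1) = p.1.2 * p.1.1 * p.2 := by
    rw [← mul_assoc, e2, neg_mul, mul_assoc, e1, mul_neg, neg_neg, mul_assoc]
  simp only [Function.comp]
  rw [mul_smul_comm, smul_mul_assoc, mul_sub, sub_mul, e3, e4]

end BanachAlgebra

end

/-! ### Forms preserved by nearby complex structures -/

section

variable {V : Type*} [NormedAddCommGroup V] [NormedSpace ℂ V]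

/-- The form `Ω` is invariant under the endomorphism `J`. -/
def Preserves (Ω : LinearMap.BilinForm ℝ V) (J : REnd V) : Prop := ∀ x y, Ω (J x) (J y) = Ω x y

/-- Deforming `J` in the direction `T`, through complex structures anticommuting with `I`, gives a
linear condition on the forms preserved near `J`. -/
lemma Preserves.derivative {Ω : LinearMap.BilinForm ℝ V} {I J T : REnd V} {δ : ℝ}
    (hJ : J * J = -1) (hIJ : I * J = -(J * I)) (hT : T * T = δ • (1 : REnd V))
    (hJT : J * T = -(T * J)) (hIT : I * T = -(T * I))
    (h : ∀ᶠ L in 𝓝 J, L * L = -1 → I * L = -(L * I) → Preserves Ω L) (x y : V) :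
    Ω (J x) (T y) + Ω (T x) (J y) = 0 := by
  let f : ℝ → REnd V := fun s => √(1 + δ * s ^ 2) • J + s • T
  have hf : Tendsto f (𝓝 0) (𝓝 J) := by
    have h1 : Continuous f := by fun_prop
    have h2 := h1.tendsto 0
    simpa [f] using h2
  have hf' : Tendsto (fun s => f (-s)) (𝓝 0) (𝓝 J) := by
    have h1 : Tendsto (fun s : ℝ => -s) (𝓝 0) (𝓝 0) := by
      simpa using (continuous_neg.tendsto (0 : ℝ))
    exact hf.comp h1
  have hc : ∀ᶠ s : ℝ in 𝓝 0, 0 < 1 + δ * s ^ 2 := by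
    have h1 : Continuous fun s : ℝ => 1 + δ * s ^ 2 := by fun_prop
    exact (h1.tendsto 0).eventually (lt_mem_nhds (by simp))
  have hev : ∀ᶠ s : ℝ in 𝓝[≠] 0, 0 < 1 + δ * s ^ 2 ∧
      (f s * f s = -1 → I * f s = -(f s * I) → Preserves Ω (f s)) ∧
      (f (-s) * f (-s) = -1 → I * f (-s) = -(f (-s) * I) → Preserves Ω (f (-s))) :=
    (hc.and ((hf.eventually h).and (hf'.eventually h))).filter_mono nhdsWithin_le_nhds
  obtain ⟨s, ⟨hpos, h1, h2⟩, hs⟩ := (hev.and self_mem_nhdsWithin).exists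
  have hs0 : s ≠ 0 := hs
  have hsq : ∀ t : ℝ, t ^ 2 = s ^ 2 → f t * f t = -1 := fun t ht => by
    have hr : √(1 + δ * t ^ 2) * √(1 + δ * t ^ 2) = 1 + δ * s ^ 2 := by
      rw [ht]; exact Real.mul_self_sqrt hpos.le
    have ht' : t * t = s ^ 2 := by rw [← pow_two, ht]
    simp only [f, add_mul, mul_add, smul_mul_smul_comm, hJ, hT, hJT, hr, ht']
    module
  have hanti : ∀ t : ℝ, I * f t = -(f t * I) := fun t => by
    simp only [f, add_mul, mul_add, smul_mul_assoc, mul_smul_comm, hIJ, hIT]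
    module
  have e1 := h1 (hsq s rfl) (hanti s) x y
  have e2 := h2 (hsq (-s) (neg_sq s)) (hanti _) x y
  have hr0 : √(1 + δ * s ^ 2) ≠ 0 := (Real.sqrt_pos.2 hpos).ne'
  simp only [f, neg_sq, add_apply, smul_apply, map_add, map_smul,
    LinearMap.add_apply, LinearMap.smul_apply, smul_eq_mul] at e1 e2
  have e3 : (4 * (s * √(1 + δ * s ^ 2))) * (Ω (J x) (T y) + Ω (T x) (J y)) = 0 := by
    linear_combination 2 * e1 - 2 * e2
  exact (mul_eq_zero.1 e3).resolve_left (by positivity)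

variable [FiniteDimensional ℂ V]

open Quaternion in
/-- Two anticommuting complex structures make `V` a left vector space over the quaternions. In a
basis, right multiplication of the coordinates by `i` and by `j` commutes with the given
structures. -/
lemma exists_commuting_quaternions {I J : REnd V} (hI : I * I = -1) (hJ : J * J = -1)
    (hIJ : I * J = -(J * I)) : ∃ E F : REnd V, E * E = -1 ∧ F * F = -1 ∧ E * F = -(F * E) ∧
      I * E = E * I ∧ J * E = E * J ∧ I * F = F * I ∧ J * F = F * J := by
  let q : QuaternionAlgebra.Basis (REnd V) (-1 : ℝ) 0 (-1) :=
    { i := I, j := J, k := I * J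
      i_mul_i := by simp [hI]
      j_mul_j := by simp [hJ]
      i_mul_j := rfl
      j_mul_i := by rw [hIJ]; simp }
  let f : ℍ[ℝ] →ₐ[ℝ] REnd V := q.liftHom
  let _ : Module ℍ[ℝ] V := Module.compHom V (f : ℍ[ℝ] →+* REnd V)
  have hsmul : ∀ (p : ℍ[ℝ]) (x : V), p • x = f p x := fun p x => rfl
  have hfr : ∀ r : ℝ, f (r : ℍ[ℝ]) = r • (1 : REnd V) := fun r => by
    have := f.commutes r
    rwa [Algebra.algebraMap_eq_smul_one (A := REnd V)] at this
  let qi : ℍ[ℝ] := ⟨0, 1, 0, 0⟩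
  let qj : ℍ[ℝ] := ⟨0, 0, 1, 0⟩
  have hqi : f qi = I := by
    show q.lift _ = I
    simp [QuaternionAlgebra.Basis.lift, qi, q]
  have hqj : f qj = J := by
    show q.lift _ = J
    simp [QuaternionAlgebra.Basis.lift, qj, q]
  have hii : qi * qi = -1 := by
    ext <;> simp [Quaternion.re_mul, Quaternion.imI_mul, Quaternion.imJ_mul, Quaternion.imK_mul] <;>
      simp [qi]
  have hjj : qj * qj = -1 := by
    ext <;> simp [Quaternion.re_mul, Quaternion.imI_mul, Quaternion.imJ_mul, Quaternion.imK_mul] <;>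
      simp [qj]
  have hij : qj * qi = -(qi * qj) := by
    ext <;> simp [Quaternion.re_mul, Quaternion.imI_mul, Quaternion.imJ_mul, Quaternion.imK_mul] <;>
      simp [qi, qj]
  let b := Module.Free.chooseBasis ℍ[ℝ] V
  let R : ℍ[ℝ] → (V →ₗ[ℍ[ℝ]] V) := fun p => b.constr ℕ fun k => p • b k
  have hRb : ∀ p k, R p (b k) = p • b k := fun p k => b.constr_basis _ _ _
  have hRR : ∀ p p' x, R p (R p' x) = R (p' * p) x := fun p p' x => by
    have : R p ∘ₗ R p' = R (p' * p) := b.ext fun k => by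
      rw [LinearMap.comp_apply, hRb, map_smul, hRb, hRb, mul_smul]
    exact congrArg (fun g : V →ₗ[ℍ[ℝ]] V => g x) this
  have hRneg : ∀ p x, R (-p) x = -R p x := fun p x => by
    have : R (-p) = -R p := b.ext fun k => by
      rw [LinearMap.neg_apply, hRb, hRb, neg_smul]
    exact congrArg (fun g : V →ₗ[ℍ[ℝ]] V => g x) this
  have hR1 : ∀ x, R 1 x = x := fun x => by
    have : R 1 = LinearMap.id := b.ext fun k => by rw [hRb, one_smul, LinearMap.id_apply]
    exact congrArg (fun g : V →ₗ[ℍ[ℝ]] V => g x) this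
  let S : ℍ[ℝ] → REnd V := fun p => LinearMap.toContinuousLinearMap
    { toFun := R p
      map_add' := (R p).map_add
      map_smul' := fun r x => by
        have h1 : ∀ y : V, r • y = (r : ℍ[ℝ]) • y := fun y => by rw [hsmul, hfr]; rfl
        rw [RingHom.id_apply, h1, h1, map_smul] }
  have hS : ∀ p x, S p x = R p x := fun p x => rfl
  have hcomm : ∀ p p', f p * S p' = S p' * f p := fun p p' => by
    ext x
    show f p (R p' x) = R p' (f p x)
    rw [← hsmul, ← hsmul, map_smul]
  refine ⟨S qi, S qj, ?_, ?_, ?_, ?_, ?_, ?_, ?_⟩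
  · ext x
    show R qi (R qi x) = -x
    rw [hRR, hii, hRneg, hR1]
  · ext x
    show R qj (R qj x) = -x
    rw [hRR, hjj, hRneg, hR1]
  · ext x
    show R qi (R qj x) = -R qj (R qi x)
    rw [hRR, hRR, hij, hRneg]
  · rw [← hqi, hcomm]
  · rw [← hqj, hcomm]
  · rw [← hqi, hcomm]
  · rw [← hqj, hcomm]

/-- A nonzero form is not preserved by all complex structures near `J` that anticommute with `I`:
otherwise all endomorphisms commuting with `I` and `J` would be self-adjoint for it. -/
lemma not_eventually_preserves {Ω : LinearMap.BilinForm ℝ V} (hΩ : Ω ≠ 0) {I J : REnd V}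
    (hI : I * I = -1) (hJ : J * J = -1) (hIJ : I * J = -(J * I)) :
    ¬ ∀ᶠ L in 𝓝 J, L * L = -1 → I * L = -(L * I) → Preserves Ω L := by
  intro h
  obtain ⟨E, F, hE, hF, hEF, hIE, hJE, hIF, hJF⟩ := exists_commuting_quaternions hI hJ hIJ
  have hJI : J * I = -(I * J) := by rw [hIJ, neg_neg]
  have hKK : I * J * (I * J) = -1 := mul_sq_eq_neg_one hI hJ hIJ
  have hJJ : ∀ x, J (J x) = -x := fun x => congrArg (fun S : REnd V => S x) hJ
  have hII : ∀ x, I (I x) = -x := fun x => congrArg (fun S : REnd V => S x) hI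
  -- the derivative in the direction `IJG`
  have key : ∀ (G : REnd V) (δ : ℝ), G * G = -(δ • (1 : REnd V)) → I * G = G * I → J * G = G * J →
      ∀ u v, Ω (I (G u)) v + Ω u (I (G v)) = 0 := by
    intro G δ hG hIG hJG u v
    have hKG : I * J * G = G * (I * J) := by rw [mul_assoc, hJG, ← mul_assoc, hIG, mul_assoc]
    have e := Preserves.derivative (T := I * J * G) (δ := δ) hJ hIJ
      (by rw [mul_assoc (I * J), ← mul_assoc G, ← hKG, mul_assoc (I * J) G, hG, ← mul_assoc, hKK]
          simp)
      (by rw [hKG, ← mul_assoc, hJG, mul_assoc, mul_assoc G, ← mul_neg, ← mul_assoc J, hJI,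
            neg_mul])
      (by rw [hKG, ← mul_assoc, hIG, mul_assoc, mul_assoc G, mul_assoc I J, hJI,
            mul_neg, mul_neg, neg_neg])
      h (-J u) (-J v)
    have e1 : ∀ w, (I * J * G) (-J w) = I (G w) := fun w => by
      have h1 : J (G (J w)) = G (J (J w)) := congrArg (fun S : REnd V => S (J w)) hJG
      show I (J (G (-J w))) = _
      simp only [map_neg, h1, hJJ, neg_neg]
    rw [e1, e1] at e
    simp only [map_neg, hJJ, neg_neg] at e
    linarith
  have key1 : ∀ u v, Ω (I u) v + Ω u (I v) = 0 :=
    key 1 (-1) (by simp) (by simp) (by simp)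
  have adj : ∀ G : REnd V, G * G = -1 → I * G = G * I → J * G = G * J →
      ∀ u v, Ω (G u) v = Ω u (G v) := by
    intro G hG hIG hJG u v
    have e1 := key G 1 (by rw [one_smul, hG]) hIG hJG u (-I v)
    have e2 := key1 (G u) (-I v)
    have h1 : G (I v) = I (G v) := (congrArg (fun S : REnd V => S v) hIG).symm
    simp only [map_neg, h1, hII, neg_neg] at e1 e2
    linarith
  refine hΩ (LinearMap.ext fun u => LinearMap.ext fun v => ?_)
  have hEFsq : E * F * (E * F) = -1 := mul_sq_eq_neg_one hE hF hEF
  have zero : ∀ v, Ω u (E (F v)) = 0 := fun v => by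
    have e1 := adj (E * F) hEFsq (by rw [← mul_assoc, hIE, mul_assoc, hIF, mul_assoc])
      (by rw [← mul_assoc, hJE, mul_assoc, hJF, mul_assoc]) u v
    have e2 := adj E hE hIE hJE (F u) v
    have e3 := adj F hF hIF hJF u (E v)
    have e4 : E (F v) = -F (E v) := congrArg (fun S : REnd V => S v) hEF
    have e5 : Ω (E (F u)) v = Ω u (E (F v)) := e1
    have e6 : Ω u (E (F v)) = -Ω u (F (E v)) := by rw [e4, map_neg]
    linarith
  have e7 : E (F (-(E (F v)))) = v := by
    have : E (F (E (F v))) = -v := congrArg (fun S : REnd V => S v) hEFsq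
    rw [map_neg, map_neg, this, neg_neg]
  rw [← e7, zero]
  rfl

end

/-! ### Generic pairs of anticommuting complex structures -/

section

/-- A form of the Baire category theorem: a nonempty locally closed set is not covered by countably
many closed sets none of which contains a relatively open part of it. -/
lemma exists_mem_forall_notMem {X ι : Type*} [TopologicalSpace X] [T2Space X]
    [LocallyCompactSpace X] [Countable ι] {W : Set X} (hW : IsLocallyClosed W) (hne : W.Nonempty)
    {F : ι → Set X} (hF : ∀ i, IsClosed (F i))
    (h : ∀ i, ∀ w ∈ W, ∃ᶠ x in 𝓝 w, x ∈ W ∧ x ∉ F i) : ∃ w ∈ W, ∀ i, w ∉ F i := by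
  have : LocallyCompactSpace W := hW.locallyCompactSpace
  have : Nonempty W := hne.to_subtype
  have hd : Dense (⋂ i, (Subtype.val ⁻¹' (F i)ᶜ : Set W)) := by
    refine dense_iInter_of_isOpen
      (fun i => (hF i).isOpen_compl.preimage continuous_subtype_val) fun i w => ?_
    rw [mem_closure_iff_frequently]
    have h2 : ∃ᶠ x in Filter.map (Subtype.val : W → X) (𝓝 w), x ∉ F i := by
      rw [map_nhds_subtype_val]
      refine (frequently_nhdsWithin_iff.2 ((h i w w.2).mono fun x hx => ⟨hx.2, hx.1⟩))
    exact h2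
  obtain ⟨w, hw⟩ := hd.nonempty
  exact ⟨w, w.2, fun i => Set.mem_iInter.1 hw i⟩

variable {V : Type*} [NormedAddCommGroup V] [NormedSpace ℂ V]

/-- The nonzero bilinear forms that are integral on `Γ`. -/
def integralForms (Γ : Submodule ℤ V) : Set (LinearMap.BilinForm ℝ V) :=
  {Ω | Ω ≠ 0 ∧ ∀ x ∈ Γ, ∀ y ∈ Γ, ∃ k : ℤ, Ω x y = k}

lemma isGeneric_of_forall_not_preserves {Γ : Submodule ℤ V} {I : Compl V}
    (h : ∀ Ω ∈ integralForms Γ, ¬ Preserves Ω (I : REnd V)) : IsGeneric Γ I := by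
  rw [IsGeneric, eq_bot_iff]
  rintro Ω ⟨-, h2, h3⟩
  by_contra h0
  exact h Ω ⟨h0, h2⟩ h3

variable [FiniteDimensional ℂ V]

/-- A form integral on `Γ` is determined by the integers it takes on pairs of basis vectors. -/
lemma countable_integralForms (Γ : Submodule ℤ V) [DiscreteTopology Γ] [IsZLattice ℝ Γ] :
    (integralForms Γ).Countable := by
  have : Module.Finite ℤ Γ := ZLattice.module_finite ℝ Γ
  have : Module.Free ℤ Γ := ZLattice.module_free ℝ Γ
  let b := Module.Free.chooseBasis ℤ Γ
  let c := b.ofZLatticeBasis ℝ Γ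
  have hc : ∀ i, c i ∈ Γ := fun i => by
    rw [b.ofZLatticeBasis_apply ℝ Γ i]
    exact (b i).2
  have hex : ∀ Ω : LinearMap.BilinForm ℝ V, ∃ k : Module.Free.ChooseBasisIndex ℤ Γ →
      Module.Free.ChooseBasisIndex ℤ Γ → ℤ, Ω ∈ integralForms Γ →
      ∀ i j, Ω (c i) (c j) = k i j := fun Ω => by
    by_cases h : Ω ∈ integralForms Γ
    · choose k hk using fun i j => h.2 (c i) (hc i) (c j) (hc j)
      exact ⟨k, fun _ => hk⟩
    · exact ⟨0, fun h' => absurd h' h⟩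
  choose k hk using hex
  refine Set.MapsTo.countable_of_injOn (f := k) (Set.mapsTo_univ _ _) ?_ Set.countable_univ
  intro Ω hΩ Ω' hΩ' h
  refine LinearMap.BilinForm.ext_basis c fun i j => ?_
  rw [hk Ω hΩ, hk Ω' hΩ', h]

lemma isClosed_setOf_preserves (Ω : LinearMap.BilinForm ℝ V) :
    IsClosed {J : REnd V | Preserves Ω J} := by
  let Ω' : V →L[ℝ] V →L[ℝ] ℝ := LinearMap.toContinuousLinearMap
    ((LinearMap.toContinuousLinearMap (𝕜 := ℝ) (E := V) (F' := ℝ)).toLinearMap ∘ₗ Ω)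
  have h : ∀ x y, Ω x y = Ω' x y := fun x y => rfl
  simp only [Preserves, Set.ofPred_forall]
  refine isClosed_iInter fun x => isClosed_iInter fun y => isClosed_eq ?_ continuous_const
  simp only [h]
  fun_prop

/-- For `P` and `Q` close to `I₀` there are `J₁` and `J₂`, close to `J₀` and to `J₀ I₀`, such that
consecutive terms of `P, J₁, J₂, Q` anticommute, and that preserve none of countably many given
forms. In the space of pairs `(J₁, J₂)` either term is locally a continuous function of the other
one, which can be deformed freely, so that the excluded pairs form a meagre set. -/
lemma eventually_exists_anticommuting_chain {S : Set (LinearMap.BilinForm ℝ V)} (hS : S.Countable)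
    (hS0 : ∀ Ω ∈ S, Ω ≠ 0) {I₀ J₀ : REnd V} (hI : I₀ * I₀ = -1) (hJ : J₀ * J₀ = -1)
    (hIJ : I₀ * J₀ = -(J₀ * I₀)) {N : Set (REnd V)} (hN : N ∈ 𝓝 J₀) :
    ∀ᶠ p : REnd V × REnd V in 𝓝 (I₀, I₀), p.1 * p.1 = -1 → p.2 * p.2 = -1 →
      ∃ J₁ J₂ : REnd V, J₁ ∈ N ∧ J₁ * J₁ = -1 ∧ J₂ * J₂ = -1 ∧ p.1 * J₁ = -(J₁ * p.1) ∧
        J₁ * J₂ = -(J₂ * J₁) ∧ p.2 * J₂ = -(J₂ * p.2) ∧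
        ∀ Ω ∈ S, ¬ Preserves Ω J₁ ∧ ¬ Preserves Ω J₂ := by
  have : CompleteSpace V := FiniteDimensional.complete ℂ V
  have : ProperSpace (REnd V) := FiniteDimensional.proper ℝ _
  have hJI : J₀ * I₀ = -(I₀ * J₀) := by rw [hIJ, neg_neg]
  have hK := mul_sq_eq_neg_one hJ hI hJI
  have u3 := eventually_eq_third hJ hI hJI
  have u5 := tendsto_third hJ hI hJI
  obtain ⟨K₀, hK₀⟩ : ∃ K, K = J₀ * I₀ := ⟨_, rfl⟩
  rw [← hK₀] at hK u3 u5
  have hIK : I₀ * K₀ = J₀ := by rw [hK₀, hJI, mul_neg, ← mul_assoc, hI]; simp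
  have hKI : K₀ * I₀ = -J₀ := by rw [hK₀, mul_assoc, hI]; simp
  have hIK' : I₀ * K₀ = -(K₀ * I₀) := by rw [hIK, hKI, neg_neg]
  -- good position of `P, Q, J₁, J₂`
  let x₀ : (REnd V × REnd V) × REnd V × REnd V := ((I₀, I₀), J₀, K₀)
  have c : ∀ {f : (REnd V × REnd V) × REnd V × REnd V → (REnd V × REnd V)},
      Continuous f → Tendsto f (𝓝 x₀) (𝓝 (f x₀)) := fun hf => hf.tendsto _
  have c' : ∀ {f : (REnd V × REnd V) × REnd V × REnd V → (REnd V × REnd V) × REnd V},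
      Continuous f → Tendsto f (𝓝 x₀) (𝓝 (f x₀)) := fun hf => hf.tendsto _
  have t1 := c (f := fun x => (x.2.1, x.1.2)) (by fun_prop)
  have t2 := c (f := fun x => (x.1.1, x.2.2)) (by fun_prop)
  have t3 := c' (f := fun x => ((x.2.1, x.1.2), x.2.2)) (by fun_prop)
  have t4 := c' (f := fun x => ((x.1.1, x.2.2), x.2.1)) (by fun_prop)
  have t5 : Tendsto (fun x : (REnd V × REnd V) × REnd V × REnd V => x.2.1) (𝓝 x₀) (𝓝 J₀) :=
    (continuous_fst.comp continuous_snd).tendsto x₀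
  have u4 := eventually_eq_third hI hK hIK'
  rw [hIK] at u4
  have good := (t1.eventually (eventually_third hJ hI hJI)).and
    ((t1.eventually (eventually_continuousAt_third hJ hI hJI)).and
    ((t2.eventually (eventually_third hI hK hIK')).and
    ((t2.eventually (eventually_continuousAt_third hI hK hIK')).and
    ((t3.eventually u3).and
    ((t4.eventually u4).and (t5.eventually_mem hN))))))
  rw [nhds_prod_eq, eventually_prod_iff] at good
  obtain ⟨pU, hU, pO, hO, good⟩ := good
  obtain ⟨O, hOsub, hOopen, hO0⟩ := mem_nhds_iff.1 hO
  -- the first candidate pair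
  have s1 : Tendsto (fun p : REnd V × REnd V => (p.1, K₀)) (𝓝 (I₀, I₀)) (𝓝 (I₀, K₀)) :=
    (continuous_fst.prodMk continuous_const).tendsto _
  have s2 : Tendsto (fun p : REnd V × REnd V => third p.1 K₀) (𝓝 (I₀, I₀)) (𝓝 J₀) := by
    have := (tendsto_third hI hK hIK').comp s1
    rwa [hIK] at this
  have s3 : Tendsto (fun p : REnd V × REnd V => (third p.1 K₀, p.2)) (𝓝 (I₀, I₀))
      (𝓝 (J₀, I₀)) := s2.prodMk_nhds (continuous_snd.tendsto _)
  have s4 := s2.prodMk_nhds (u5.comp s3)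
  filter_upwards [hU, s1.eventually (eventually_third hI hK hIK'),
    s3.eventually (eventually_third hJ hI hJI), s4.eventually_mem (hOopen.mem_nhds hO0)]
    with p hp hp1 hp2 hp3 hP hQ
  obtain ⟨P, Q⟩ := p
  simp only [Function.comp] at hP hQ hp1 hp2 hp3
  have good' : ∀ x ∈ O, _ := fun x hx => good hp (hOsub hx)
  let C : Set (REnd V × REnd V) := {x | x.1 * x.1 = -1 ∧ x.2 * x.2 = -1 ∧ P * x.1 = -(x.1 * P) ∧
    x.1 * x.2 = -(x.2 * x.1) ∧ Q * x.2 = -(x.2 * Q)}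
  have hC : IsClosed C := by
    refine (isClosed_eq ?_ ?_).inter ((isClosed_eq ?_ ?_).inter ((isClosed_eq ?_ ?_).inter
      ((isClosed_eq ?_ ?_).inter (isClosed_eq ?_ ?_)))) <;> fun_prop
  have hW : IsLocallyClosed (O ∩ C) := hOopen.isLocallyClosed.inter hC.isLocallyClosed
  have hne : (O ∩ C).Nonempty := by
    obtain ⟨a1, a2, a3⟩ := hp1 hP hK
    obtain ⟨b1, b2, b3⟩ := hp2 a1 hQ
    exact ⟨_, hp3, a1, b1, a2, b2, b3⟩
  have : Countable S := hS.to_subtype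
  obtain ⟨⟨J₁, J₂⟩, ⟨hwO, h1, h2, h3, h4, h5⟩, hw⟩ := exists_mem_forall_notMem (ι := S × Bool)
    (F := fun i => if i.2 then {x | Preserves i.1.1 x.1} else {x | Preserves i.1.1 x.2})
    hW hne (by
      rintro ⟨Ω, _ | _⟩
      · exact (isClosed_setOf_preserves Ω.1).preimage continuous_snd
      · exact (isClosed_setOf_preserves Ω.1).preimage continuous_fst) (by
      rintro ⟨Ω, i⟩ ⟨A, B⟩ ⟨hwO, h1, h2, h3, h4, h5⟩
      simp only at h1 h2 h3 h4 h5
      obtain ⟨g1, g2, g3, g4, g5, g6, -⟩ := good' _ hwO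
      simp only at g1 g2 g3 g4 g5 g6
      have hB : B = third A Q := g5 h1 hQ h2 h4 h5
      have hA : A = third P B := g6 hP h2 h1 h3 (by rw [h4, neg_neg])
      -- deform one of the two terms, the other one following as `third`
      cases i
      · have hf : Tendsto (fun L => (third P L, L)) (𝓝 B) (𝓝 (A, B)) := by
          have e : ContinuousAt (fun L : REnd V => third P L) B :=
            ContinuousAt.comp (f := fun L : REnd V => (P, L)) (g := fun p => third p.1 p.2) g4
              (by fun_prop)
          have e' := e.tendsto
          rw [← hA] at e'
          exact e'.prodMk_nhds tendsto_id
        have fr := not_eventually_preserves (hS0 Ω.1 Ω.2) hQ h2 h5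
        rw [not_eventually] at fr
        refine hf.frequently ((fr.and_eventually (hf.eventually_mem (hOopen.mem_nhds hwO))).mono ?_)
        rintro L ⟨hL, hLO⟩
        simp only [Classical.not_imp] at hL
        obtain ⟨-, -, g3, -⟩ := good' _ hLO
        obtain ⟨k1, k2, k3⟩ := g3 hP hL.1
        exact ⟨⟨hLO, k1, hL.1, k2, by simp only at k3 ⊢; rw [k3, neg_neg], hL.2.1⟩, hL.2.2⟩
      · have hf : Tendsto (fun L => (L, third L Q)) (𝓝 A) (𝓝 (A, B)) := by
          have e : ContinuousAt (fun L : REnd V => third L Q) A :=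
            ContinuousAt.comp (f := fun L : REnd V => (L, Q)) (g := fun p => third p.1 p.2) g2
              (by fun_prop)
          have e' := e.tendsto
          rw [← hB] at e'
          exact tendsto_id.prodMk_nhds e'
        have fr := not_eventually_preserves (hS0 Ω.1 Ω.2) hP h1 h3
        rw [not_eventually] at fr
        refine hf.frequently ((fr.and_eventually (hf.eventually_mem (hOopen.mem_nhds hwO))).mono ?_)
        rintro L ⟨hL, hLO⟩
        simp only [Classical.not_imp] at hL
        obtain ⟨g1, -⟩ := good' _ hLO
        obtain ⟨k1, k2, k3⟩ := g1 hL.1 hQ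
        exact ⟨⟨hLO, hL.1, k1, hL.2.1, k2, k3⟩, hL.2.2⟩)
  refine ⟨J₁, J₂, (good' _ hwO).2.2.2.2.2.2, h1, h2, h3, h4, h5, fun Ω hΩ => ⟨?_, ?_⟩⟩
  · exact hw (⟨Ω, hΩ⟩, true)
  · exact hw (⟨Ω, hΩ⟩, false)

end

/-! ### Generic chains of twistor spheres -/

section

variable {V : Type*} [NormedAddCommGroup V] [NormedSpace ℂ V]


lemma IsTwistorSphere.eq_of_mem [Nontrivial V] {S S' : Set (Compl V)} (hS : IsTwistorSphere S)
    (hS' : IsTwistorSphere S') {M T : Compl V} (hM : M ∈ S) (hM' : M ∈ S') (hT : T ∈ S)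
    (hT' : T ∈ S') (h1 : T ≠ M) (h2 : (T : REnd V) ≠ -M) : S = S' := by
  obtain ⟨q, rfl⟩ := hS
  obtain ⟨q', rfl⟩ := hS'
  ext L
  rw [q.mem_range_iff_of_mem hM hT h1 h2, q'.mem_range_iff_of_mem hM' hT' h1 h2]

/-- Opposite complex structures preserve the same forms. -/
lemma IsGeneric.of_eq_neg {Γ : Submodule ℤ V} {M T : Compl V} (hM : IsGeneric Γ M)
    (h : (T : REnd V) = -M) : IsGeneric Γ T := by
  rw [IsGeneric, eq_bot_iff] at hM ⊢
  rintro Ω ⟨h1, h2, h3⟩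
  refine hM ⟨h1, h2, fun x y => ?_⟩
  have := h3 x y
  rw [h] at this
  simpa using this

/-- Two periods are adjacent if they lie on a common twistor sphere. -/
def Adjacent (P Q : Compl V) : Prop := ∃ S : Set (Compl V), IsTwistorSphere S ∧ P ∈ S ∧ Q ∈ S

lemma Adjacent.symm {P Q : Compl V} (h : Adjacent P Q) : Adjacent Q P := by
  obtain ⟨S, h1, h2, h3⟩ := h
  exact ⟨S, h1, h3, h2⟩

lemma adjacent_of_anticommute {P Q : Compl V}
    (h : (P : REnd V) * Q = -((Q : REnd V) * P)) : Adjacent P Q := by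
  let q : QuaternionicPair V := ⟨P, Q, P.2, Compl.sq Q.2, h⟩
  exact ⟨_, ⟨q, rfl⟩, q.I_mem_range, q.J_mem_range⟩

lemma Compl.mem_of_anticommute {P Q : REnd V} (hP : P ∈ Compl V) (hQ : Q * Q = -1)
    (h : P * Q = -(Q * P)) : Q ∈ Compl V :=
  QuaternionicPair.J_mem ⟨P, Q, hP, hQ, h⟩

lemma Adjacent.joined {Γ : Submodule ℤ V} {P Q : Compl V} (h : Adjacent P Q) :
    JoinedByGenericChain Γ P Q := by
  obtain ⟨S, h1, h2, h3⟩ := h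
  exact ⟨0, fun _ => S, fun _ => h1, h2, h3, fun k => k.elim0⟩

/-- A generic chain can be prolonged at a generic endpoint. If the added sphere is the last one of
the chain there is nothing to do, and otherwise the two spheres meet in `±M` only. -/
lemma JoinedByGenericChain.append [Nontrivial V] {Γ : Submodule ℤ V} {P M Q : Compl V}
    (h : JoinedByGenericChain Γ P M) (hM : IsGeneric Γ M) (hMQ : Adjacent M Q) :
    JoinedByGenericChain Γ P Q := by
  obtain ⟨m, S, h1, h2, h3, h4⟩ := h
  obtain ⟨S', k1, k2, k3⟩ := hMQ
  by_cases heq : S (Fin.last m) = S'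
  · exact ⟨m, S, h1, h2, heq ▸ k3, h4⟩
  · refine ⟨m + 1, Fin.snoc (α := fun _ => Set (Compl V)) S S', fun k => ?_, ?_, ?_, fun k => ?_⟩
    · induction k using Fin.lastCases with
      | last => simpa using k1
      | cast k => simpa using h1 k
    · rw [← Fin.castSucc_zero, Fin.snoc_castSucc]
      exact h2
    · simpa using k3
    · rw [Fin.snoc_castSucc]
      induction k using Fin.lastCases with
      | last =>
        rw [Fin.succ_last, Fin.snoc_last]
        refine ⟨⟨M, h3, k2⟩, fun T hT => ?_⟩
        by_cases e1 : T = M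
        · rwa [e1]
        by_cases e2 : (T : REnd V) = -M
        · exact hM.of_eq_neg e2
        exact absurd ((h1 _).eq_of_mem k1 h3 k2 hT.1 hT.2 e1 e2) heq
      | cast k =>
        rw [Fin.succ_castSucc, Fin.snoc_castSucc]
        exact h4 k

/-- Chains of adjacent generic periods. -/
def GenericPath (Γ : Submodule ℤ V) : Compl V → Compl V → Prop :=
  Relation.ReflTransGen fun P Q => Adjacent P Q ∧ IsGeneric Γ P ∧ IsGeneric Γ Q

lemma GenericPath.symm {Γ : Submodule ℤ V} {P Q : Compl V} (h : GenericPath Γ P Q) :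
    GenericPath Γ Q P := by
  have : Std.Symm fun A B : Compl V => Adjacent A B ∧ IsGeneric Γ A ∧ IsGeneric Γ B :=
    ⟨fun A B hAB => ⟨hAB.1.symm, hAB.2.2, hAB.2.1⟩⟩
  exact Relation.ReflTransGen.stdSymm.symm _ _ h

/-- Only the interior periods of a chain have to be generic. -/
lemma GenericPath.joined [Nontrivial V] {Γ : Submodule ℤ V} {P A B Q : Compl V}
    (h : GenericPath Γ A B) (hA : IsGeneric Γ A) (hPA : Adjacent P A) (hBQ : Adjacent B Q) :
    JoinedByGenericChain Γ P Q := by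
  have key : JoinedByGenericChain Γ P B ∧ IsGeneric Γ B := by
    clear hBQ
    induction h with
    | refl => exact ⟨hPA.joined, hA⟩
    | tail _ h ih => exact ⟨ih.1.append h.2.1 h.1, h.2.2⟩
  exact key.1.append key.2 hBQ

variable [FiniteDimensional ℂ V]

variable (V) in
/-- On a space of even complex dimension, `(u, v) ↦ (-v̄, ū)` is a quaternionic structure. -/
lemma exists_anticommuting_stdJ {n : ℕ} (hV : Module.finrank ℂ V = 2 * n) :
    ∃ J : REnd V, J * J = -1 ∧ stdJ V * J = -(J * stdJ V) := by
  have hfr : Module.finrank ℂ V = Module.finrank ℂ ((Fin n → ℂ) × (Fin n → ℂ)) := by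
    rw [hV]; simp [two_mul]
  let e : V ≃ₗ[ℂ] (Fin n → ℂ) × (Fin n → ℂ) := LinearEquiv.ofFinrankEq _ _ hfr
  let f : (Fin n → ℂ) × (Fin n → ℂ) → (Fin n → ℂ) × (Fin n → ℂ) :=
    fun p => (fun i => -conj (p.2 i), fun i => conj (p.1 i))
  have hff : ∀ p, f (f p) = -p := fun p => by
    ext i <;> simp [f]
  have hfI : ∀ p, f (Complex.I • p) = -(Complex.I • f p) := fun p => by
    ext i <;> simp [f]
  have hfadd : ∀ p p', f (p + p') = f p + f p' := fun p p' => by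
    ext i <;> simp [f]
    ring
  have hfreal : ∀ (r : ℝ) p, f ((r : ℂ) • p) = (r : ℂ) • f p := fun r p => by
    ext i <;> simp [f]
  let L : V →ₗ[ℝ] V :=
    { toFun := fun x => e.symm (f (e x))
      map_add' := fun x y => by rw [map_add, hfadd, map_add]
      map_smul' := fun r x => by
        rw [← Complex.coe_smul, map_smul, RingHom.id_apply, hfreal, map_smul, Complex.coe_smul] }
  refine ⟨LinearMap.toContinuousLinearMap L, ?_, ?_⟩
  · ext x
    show e.symm (f (e (e.symm (f (e x))))) = -x
    rw [e.apply_symm_apply, hff, map_neg, e.symm_apply_apply]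
  · ext x
    show Complex.I • e.symm (f (e x)) = -e.symm (f (e (Complex.I • x)))
    rw [map_smul, hfI, map_neg, neg_neg, map_smul]

lemma exists_anticommuting {n : ℕ} (hV : Module.finrank ℂ V = 2 * n) (I : Compl V) :
    ∃ J : REnd V, J * J = -1 ∧ (I : REnd V) * J = -(J * I) := by
  obtain ⟨J, h1, h2⟩ := exists_anticommuting_stdJ V hV
  obtain ⟨_, g, -, rfl⟩ := I
  refine ⟨(g : REnd V) * J * ((g⁻¹ : (REnd V)ˣ) : REnd V), ?_, ?_⟩
  · calc _ = (g : REnd V) * (J * J) * ((g⁻¹ : (REnd V)ˣ) : REnd V) := by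
          simp only [mul_assoc, Units.inv_mul_cancel_left]
      _ = -1 := by rw [h1]; simp
  · calc _ = (g : REnd V) * (stdJ V * J) * ((g⁻¹ : (REnd V)ˣ) : REnd V) := by
          simp only [mul_assoc, Units.inv_mul_cancel_left]
      _ = _ := by rw [h2]; simp only [mul_neg, neg_mul, mul_assoc, Units.inv_mul_cancel_left]

section Lattice

variable (Γ : Submodule ℤ V) [DiscreteTopology Γ] [IsZLattice ℝ Γ]

/-- Nearby periods are joined by a chain through two generic periods. -/
lemma eventually_exists_generic_pair {n : ℕ} (hV : Module.finrank ℂ V = 2 * n) (I : Compl V) :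
    ∀ᶠ p : Compl V × Compl V in 𝓝 (I, I), ∃ A B : Compl V, IsGeneric Γ A ∧ IsGeneric Γ B ∧
      Adjacent p.1 A ∧ Adjacent A B ∧ Adjacent B p.2 := by
  obtain ⟨J, hJ, hIJ⟩ := exists_anticommuting hV I
  have h := eventually_exists_anticommuting_chain (countable_integralForms Γ) (fun Ω h => h.1)
    (Compl.sq I.2) hJ hIJ univ_mem
  have t : Tendsto (fun p : Compl V × Compl V => ((p.1 : REnd V), (p.2 : REnd V))) (𝓝 (I, I))
      (𝓝 ((I : REnd V), (I : REnd V))) := by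
    have : Continuous (fun p : Compl V × Compl V => ((p.1 : REnd V), (p.2 : REnd V))) := by
      fun_prop
    exact this.tendsto (I, I)
  filter_upwards [t.eventually h] with p hp
  obtain ⟨A, B, -, hA, hB, hPA, hAB, hQB, hgen⟩ := hp (Compl.sq p.1.2) (Compl.sq p.2.2)
  have mA := Compl.mem_of_anticommute p.1.2 hA hPA
  have mB := Compl.mem_of_anticommute mA hB hAB
  refine ⟨⟨A, mA⟩, ⟨B, mB⟩, isGeneric_of_forall_not_preserves fun Ω h => (hgen Ω h).1,
    isGeneric_of_forall_not_preserves fun Ω h => (hgen Ω h).2, adjacent_of_anticommute hPA,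
    adjacent_of_anticommute hAB, (adjacent_of_anticommute hQB).symm⟩

/-- Generic periods are dense. -/
lemma exists_generic_mem {n : ℕ} (hV : Module.finrank ℂ V = 2 * n) {I : Compl V}
    {U : Set (Compl V)} (hU : U ∈ 𝓝 I) : ∃ M ∈ U, IsGeneric Γ M := by
  obtain ⟨J, hJ, hIJ⟩ := exists_anticommuting hV I
  obtain ⟨N, hN, hNU⟩ := mem_nhds_subtype _ _ _ |>.1 hU
  have h := (eventually_exists_anticommuting_chain (countable_integralForms Γ) (fun Ω h => h.1)
    hJ (Compl.sq I.2) (by rw [hIJ, neg_neg]) hN).self_of_nhds hJ hJ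
  obtain ⟨A, B, hAN, hA, hB, hPA, hAB, hQB, hgen⟩ := h
  have mJ := Compl.mem_of_anticommute I.2 hJ hIJ
  have mA := Compl.mem_of_anticommute mJ hA hPA
  exact ⟨⟨A, mA⟩, hNU hAN, isGeneric_of_forall_not_preserves fun Ω h => (hgen Ω h).1⟩

/-- Any two periods are joined by a generic chain: the classes of the relation that all generic
periods near `x` are joined to all generic periods near `y` are open, and the period domain is
connected. -/
lemma joinedByGenericChain {n : ℕ} (hn : 1 ≤ n) (hV : Module.finrank ℂ V = 2 * n)
    (P Q : Compl V) : JoinedByGenericChain Γ P Q := by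
  have : PreconnectedSpace (Compl V) := preconnectedSpace_compl (by omega)
  have : Nontrivial V := Module.nontrivial_of_finrank_pos (R := ℂ) (by omega)
  let r : Compl V → Compl V → Prop := fun x y => ∃ U ∈ 𝓝 x, ∃ U' ∈ 𝓝 y,
    ∀ M ∈ U, ∀ M' ∈ U', IsGeneric Γ M → IsGeneric Γ M' → GenericPath Γ M M'
  have hsymm : Std.Symm r := ⟨fun x y ⟨U, hU, U', hU', h⟩ =>
    ⟨U', hU', U, hU, fun M hM M' hM' g g' => (h M' hM' M hM g' g).symm⟩⟩
  have htrans : IsTrans (Compl V) r := ⟨fun x y z ⟨U, hU, U', hU', h⟩ ⟨W, hW, W', hW', k⟩ => by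
    obtain ⟨N, hN, gN⟩ := exists_generic_mem Γ hV (Filter.inter_mem hU' hW)
    exact ⟨U, hU, W', hW', fun M hM M' hM' g g' =>
      (h M hM N hN.1 g gN).trans (k N hN.2 M' hM' gN g')⟩⟩
  have hloc : ∀ x : Compl V, ∃ U ∈ 𝓝 x, ∀ M ∈ U, ∀ M' ∈ U, ∃ A B : Compl V, IsGeneric Γ A ∧
      IsGeneric Γ B ∧ Adjacent M A ∧ Adjacent A B ∧ Adjacent B M' := fun x => by
    have h := eventually_exists_generic_pair Γ hV x
    rw [nhds_prod_eq] at h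
    obtain ⟨U, hU, h⟩ := mem_prod_self_iff.1 h
    exact ⟨U, hU, fun M hM M' hM' => h (Set.mk_mem_prod hM hM')⟩
  have hr : ∀ x, ∀ᶠ y in 𝓝 x, r x y := fun x => by
    obtain ⟨U, hU, h⟩ := hloc x
    filter_upwards [eventually_mem_nhds_iff.2 hU] with y hy
    refine ⟨U, hU, U, hy, fun M hM M' hM' g g' => ?_⟩
    obtain ⟨A, B, gA, gB, h1, h2, h3⟩ := h M hM M' hM'
    exact ((Relation.ReflTransGen.single ⟨h1, g, gA⟩).tail ⟨h2, gA, gB⟩).tail ⟨h3, gB, g'⟩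
  obtain ⟨U, hU, U', hU', h⟩ := PreconnectedSpace.induction₂ r hr htrans P Q
  obtain ⟨W, hW, kW⟩ := hloc P
  obtain ⟨W', hW', kW'⟩ := hloc Q
  obtain ⟨M, hM, gM⟩ := exists_generic_mem Γ hV (Filter.inter_mem hU hW)
  obtain ⟨M', hM', gM'⟩ := exists_generic_mem Γ hV (Filter.inter_mem hU' hW')
  obtain ⟨A, B, gA, gB, h1, h2, h3⟩ := kW P (mem_of_mem_nhds hW) M hM.2
  obtain ⟨A', B', gA', gB', h1', h2', h3'⟩ := kW' M' hM'.2 Q (mem_of_mem_nhds hW')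
  have path : GenericPath Γ A B' :=
    (((Relation.ReflTransGen.single ⟨h2, gA, gB⟩).tail ⟨h3, gB, gM⟩).trans
      (h M hM.1 M' hM'.1 gM gM')).trans
      ((Relation.ReflTransGen.single ⟨h1', gM', gA'⟩).tail ⟨h2', gA', gB'⟩)
  exact path.joined gA h1 h3'

end Lattice

end

end TwistorPath

end

theorem mainTheorem1 {n : ℕ} (hn : 1 ≤ n)
    (V : Type*) [NormedAddCommGroup V] [NormedSpace ℂ V] [FiniteDimensional ℂ V]
    (hV : Module.finrank ℂ V = 2 * n)
    (Γ : Submodule ℤ V) [DiscreteTopology Γ] [IsZLattice ℝ Γ] :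
    (∀ q : TwistorPath.QuaternionicPair V,
      ∃ (_ : ChartedSpace ℂ (Metric.sphere (0 : EuclideanSpace ℝ (Fin 3)) 1)),
        IsManifold 𝓘(ℂ, ℂ) ω (Metric.sphere (0 : EuclideanSpace ℝ (Fin 3)) 1) ∧
        Manifold.IsSmoothEmbedding 𝓘(ℂ, ℂ) 𝓘(ℂ, TwistorPath.Anti V) ω q.sphereMap) ∧
    (∀ P Q : TwistorPath.Compl V, TwistorPath.JoinedByGenericChain Γ P Q) := by
  have : Nontrivial V := Module.nontrivial_of_finrank_pos (R := ℂ) (by omega)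
  exact ⟨fun q => ⟨TwistorPath.riemannSphere, TwistorPath.isManifold_riemannSphere,
      q.isSmoothEmbedding_sphereMap⟩,
    fun P Q => TwistorPath.joinedByGenericChain Γ hn hV P Q⟩
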